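/- Manifolds are smooth, finite-dimensional, Hausdorff, second countable and without boundary, and all maps and forms are smooth. For a surjective submersion $\pi\colon Z\to B$ write $Z^{[k]}$ for the $k$-fold fibre product of $Z$ over $B$, with face maps $d_i\colon Z^{[k+1]}\to Z^{[k]}$ omitting the $(i+1)$-st entry. For a family of face maps $d_0,\dots,d_n$ write $\delta\omega=\sum_i(-1)^i d_i^*\omega$ for forms, $\delta E=d_0^*E\otimes d_1^*E^*\otimes d_2^*E\otimes\cdots$ for principal $U(1)$-bundles, and similarly $\delta s$ for sections $s$ and $\delta\nabla$ for connections; $\delta\delta E$ has a canonical section, denoted $1$. A *bundle gerbe* $(E,Z)$ on $B$ consists of a surjective submersion $Z\to B$, a principal $U(1)$-bundle $E\to Z^{[2]}$ and a section $m$ of $\delta E\to Z^{[3]}$ with $\delta m=1$ on $Z^{[4]}$. A *rigid bundle 2-gerbe* on a manifold $X$ consists of 1. a surjective submersion $Y\to X$; 2. a 4-truncated simplicial manifold $Z_\bullet$ (that is, $Z_n$ for $n\le 4$) and a simplicial map $\pi\colon Z_\bullet\to Y^{[\bullet+1]}$ which is a surjective submersion $Z_n\to Y^{[n+1]}$ in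 each degree $n\le 4$. Let $\delta_h$ be the differential defined by the face maps of $Z_\bullet$ (or the maps they induce on the fibre products $Z_\bullet^{[k]}$ of $Z_n$ over $Y^{[n+1]}$) and of $Y^{[\bullet+1]}$, and $\delta_v$ the one defined by the face maps $Z_n^{[k+1]}\to Z_n^{[k]}$; 3. a principal $U(1)$-bundle $E\to Z_1^{[2]}$ and a section $m$ of $\delta_vE\to Z_1^{[3]}$ making $(E,Z_1)$ a bundle gerbe on $Y^{[2]}$; 4. a section $M$ of $\delta_hE\to Z_2^{[2]}$ such that $\delta_v(M)=\delta_h(m)$ over $Z_2^{[3]}$ and $\delta_h(M)=1$ over $Z_3^{[2]}$. A *rigid connective structure* on it consists of a connection $\nabla_E$ on $E$ and forms $\beta\in\Omega^2(Z_1)$, $\lambda\in\Omega^3(Y)$, $\alpha\in\Omega^1(Z_2)$ (with values in $\mathfrak u(1)=i\mathbb R$) such that - $m^*\delta_v\nabla_E=0$ on $Z_1^{[3]}$ ($\nabla_E$ is a bundle gerbe connection); - $\delta_v\beta$ is the curvature of $\nabla_E$, on $Z_1^{[2]}$ ($\beta$ is a curving); - $\pi^*\delta_h\lambda=d\beta$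 on $Z_1$ ($\lambda$ is a 2-curving); - $\delta_v\alpha=M^*\delta_h\nabla_E$ on $Z_2^{[2]}$, $\ d\alpha=\delta_h\beta$ on $Z_2$, and $\delta_h\alpha=0$ on $Z_3$. **Proposition.** Every rigid bundle 2-gerbe on every manifold $X$ admits a rigid connective structure. -/

import Mathlib

open scoped Manifold ContDiff Topology

universe u

noncomputable section

/-! ### Manifolds, smooth maps, differential forms -/

/-- A manifold: a smooth manifold without boundary, finite-dimensional, Hausdorff and second
countable. -/
structure Mfd : Type (u + 1) where
  carrier : Type u
  dim : ℕ
  [top : TopologicalSpace carrier]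
  [t2 : T2Space carrier]
  [sc : SecondCountableTopology carrier]
  [charted : ChartedSpace (EuclideanSpace ℝ (Fin dim)) carrier]
  [isManifold : IsManifold (𝓡 dim) ∞ carrier]

namespace Mfd

instance : CoeSort Mfd.{u} (Type u) := ⟨Mfd.carrier⟩

attribute [instance] Mfd.top Mfd.t2 Mfd.sc Mfd.charted Mfd.isManifold

end Mfd

/-- `f` is `C^∞`. -/
def Smooth {M N : Mfd.{u}} (f : M → N) : Prop :=
  ContMDiff (𝓡 M.dim) (𝓡 N.dim) ∞ f

/-- `f` is `C^∞` on the set `U`. -/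
def SmoothOn {M N : Mfd.{u}} (f : M → N) (U : Set M) : Prop :=
  ContMDiffOn (𝓡 M.dim) (𝓡 N.dim) ∞ f U

/-- `f` is a surjective (smooth) submersion. -/
structure IsSurjSubmersion {M N : Mfd.{u}} (f : M → N) : Prop where
  submersion : Manifold.IsSubmersion (𝓡 M.dim) (𝓡 N.dim) ∞ f
  surjective : Function.Surjective f

/-- Not necessarily smooth real differential `k`-forms: a `k`-form on each tangent space. -/
abbrev DForm (M : Mfd.{u}) (k : ℕ) : Type u :=
  (x : M) → TangentSpace (𝓡 M.dim) x [⋀^Fin k]→L[ℝ] ℝ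

namespace DForm

variable {M N : Mfd.{u}} {k : ℕ}

/-- The pullback `f^* η`. -/
def pullback (f : M → N) (η : DForm N k) : DForm M k := fun x =>
  (η (f x)).compContinuousLinearMap (mfderiv (𝓡 M.dim) (𝓡 N.dim) f x)

/-- The expression of `η` in the preferred chart at `x₀`, i.e. the pullback of `η` along the
inverse of that chart (a form on the target of the chart, an open subset of `ℝ^dim`). -/
def inChart (η : DForm M k) (x₀ : M) (y : EuclideanSpace ℝ (Fin M.dim)) :
    EuclideanSpace ℝ (Fin M.dim) [⋀^Fin k]→L[ℝ] ℝ :=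
  (η ((chartAt (EuclideanSpace ℝ (Fin M.dim)) x₀).symm y)).compContinuousLinearMap
    (mfderiv (𝓡 M.dim) (𝓡 M.dim) (chartAt (EuclideanSpace ℝ (Fin M.dim)) x₀).symm y)

/-- `η ∈ Ω^k(M)`: the form `η` is `C^∞`, i.e. its expressions in charts are. -/
def IsSmooth (η : DForm M k) : Prop :=
  ∀ x₀ : M, ContDiffOn ℝ ∞ (η.inChart x₀) (chartAt (EuclideanSpace ℝ (Fin M.dim)) x₀).target

/-- The exterior derivative `dη`, computed at `x` in the preferred chart at `x`. -/
def d (η : DForm M k) : DForm M (k + 1) := fun x =>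
  (extDeriv (η.inChart x)
      (chartAt (EuclideanSpace ℝ (Fin M.dim)) x x)).compContinuousLinearMap
    (mfderiv (𝓡 M.dim) (𝓡 M.dim) (chartAt (EuclideanSpace ℝ (Fin M.dim)) x) x)

/-- The simplicial differential `δη = ∑ i, (-1)^i d_i^* η` with respect to a family of maps
`d_0, …, d_n`. -/
def delta {n : ℕ} (face : Fin (n + 1) → M → N) (η : DForm N k) : DForm M k :=
  ∑ i : Fin (n + 1), (-1 : ℝ) ^ (i : ℕ) • pullback (face i) η

/-- The real 1-form `-i g⁻¹ dg` of a `U(1)`-valued function `g`. -/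
def dlog (g : M → Circle) : DForm M 1 := fun x =>
  ContinuousAlternatingMap.ofSubsingleton ℝ (TangentSpace (𝓡 M.dim) x) ℝ (0 : Fin 1)
    (Complex.imCLM.comp
      ((ContinuousLinearMap.mul ℝ ℂ (starRingEnd ℂ (g x : ℂ))).comp
        (mfderiv (𝓡 M.dim) 𝓘(ℝ, ℂ) (fun y => (g y : ℂ)) x)))

end DForm

/-! ### Fibre powers of a map, and truncated simplicial manifolds -/

/-- The fibre powers `Y^{[n+1]}`, `n ≥ 0`, of a map `π : Y → B`: manifolds `obj n` with `n + 1`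
projections to `Y`, which are the `(n+1)`-fold fibre products of `Y` over `B` in the category of
manifolds (these exist, and are unique up to unique isomorphism, for a submersion `π`). -/
structure FibrePowers {Y B : Mfd.{u}} (π : Y → B) where
  obj : ℕ → Mfd.{u}
  pr : (n : ℕ) → Fin (n + 1) → obj n → Y
  pr_smooth : ∀ n i, Smooth (pr n i)
  pr_eq : ∀ n i j x, π (pr n i x) = π (pr n j x)
  universal : ∀ (n : ℕ) (T : Mfd.{u}) (t : Fin (n + 1) → T → Y), (∀ i, Smooth (t i)) →
    (∀ i j x, π (t i x) = π (t j x)) →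
    ∃! h : T → obj n, Smooth h ∧ ∀ i x, pr n i (h x) = t i x

namespace FibrePowers

variable {Y B : Mfd.{u}} {π : Y → B} (C : FibrePowers π)

/-- The map `T → Y^{[n+1]}` with given components. -/
def lift {n : ℕ} {T : Mfd.{u}} (t : Fin (n + 1) → T → Y) (ht : ∀ i, Smooth (t i))
    (h : ∀ i j x, π (t i x) = π (t j x)) : T → C.obj n :=
  (C.universal n T t ht h).choose

theorem lift_smooth {n : ℕ} {T : Mfd.{u}} (t : Fin (n + 1) → T → Y) (ht : ∀ i, Smooth (t i))
    (h : ∀ i j x, π (t i x) = π (t j x)) : Smooth (C.lift t ht h) :=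
  (C.universal n T t ht h).choose_spec.1.1

theorem pr_lift {n : ℕ} {T : Mfd.{u}} (t : Fin (n + 1) → T → Y) (ht : ∀ i, Smooth (t i))
    (h : ∀ i j x, π (t i x) = π (t j x)) (i : Fin (n + 1)) (x : T) :
    C.pr n i (C.lift t ht h x) = t i x :=
  (C.universal n T t ht h).choose_spec.1.2 i x

/-- The simplicial structure of the fibre powers: `(y_0, …, y_n) ↦ (y_{f 0}, …, y_{f m})`. -/
def map {m n : ℕ} (f : Fin (m + 1) →o Fin (n + 1)) : C.obj n → C.obj m :=
  C.lift (fun i => C.pr n (f i)) (fun i => C.pr_smooth n (f i))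
    (fun i j x => C.pr_eq n (f i) (f j) x)

/-- The face map `d_i : Y^{[n+2]} → Y^{[n+1]}` omitting the entry number `i`
(counted from `0`). -/
def face {n : ℕ} (i : Fin (n + 2)) : C.obj (n + 1) → C.obj n :=
  C.map (Fin.succAboveOrderEmb i).toOrderHom

/-- The face map `d_i : Y^{[2]} → Y` omitting the entry number `i`, so that `d_0` is the second and
`d_1` is the first projection. -/
def face₀ (i : Fin 2) : C.obj 1 → Y :=
  C.pr 1 (i.succAbove 0)

end FibrePowers

/-- An `N`-truncated simplicial manifold: a contravariant functor from the finite ordinals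
`[n] = {0 < ⋯ < n}`, `n ≤ N`, and monotone maps to manifolds. The value `obj n` has no meaning for
`n > N`. -/
structure TruncSimplicialMfd (N : ℕ) where
  obj : ℕ → Mfd.{u}
  map : ∀ {m n : ℕ}, m ≤ N → n ≤ N → (Fin (m + 1) →o Fin (n + 1)) → obj n → obj m
  map_smooth : ∀ {m n : ℕ} (hm : m ≤ N) (hn : n ≤ N) (f : Fin (m + 1) →o Fin (n + 1)),
    Smooth (map hm hn f)
  map_id : ∀ {n : ℕ} (hn : n ≤ N) (z : obj n), map hn hn OrderHom.id z = z
  map_comp : ∀ {l m n : ℕ} (hl : l ≤ N) (hm : m ≤ N) (hn : n ≤ N)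
    (f : Fin (l + 1) →o Fin (m + 1)) (g : Fin (m + 1) →o Fin (n + 1)) (z : obj n),
    map hl hn (g.comp f) z = map hl hm f (map hm hn g z)

namespace TruncSimplicialMfd

variable {N : ℕ} (Z : TruncSimplicialMfd.{u} N)

/-- The face map `d_i : Z_{n+1} → Z_n`. -/
def face {n : ℕ} (hn : n + 1 ≤ N) (i : Fin (n + 2)) : Z.obj (n + 1) → Z.obj n :=
  Z.map (Nat.le_of_succ_le hn) hn (Fin.succAboveOrderEmb i).toOrderHom

end TruncSimplicialMfd

/-! ### `U(1)`-bundles, sections of tensor products of them, connections -/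

/-- A principal `U(1)`-bundle over `B`. -/
structure U1Bundle (B : Mfd.{u}) where
  P : Mfd.{u}
  proj : P → B
  proj_smooth : Smooth proj
  [act : MulAction Circle P]
  act_smooth : ContMDiff ((𝓡 1).prod (𝓡 P.dim)) (𝓡 P.dim) ∞ (fun q : Circle × P => q.1 • q.2)
  proj_smul : ∀ (z : Circle) (p : P), proj (z • p) = proj p
  free : ∀ (z : Circle) (p : P), z • p = p → z = 1
  /-- Every point has an open neighbourhood `U` with a smooth section `s` over `U` such that
  `U × U(1) → proj ⁻¹ U`, `(x, z) ↦ z • s x` has a smooth inverse `p ↦ (proj p, τ p)`. -/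
  locally_trivial : ∀ b : B, ∃ (U : Set B) (s : B → P) (τ : P → Circle), IsOpen U ∧ b ∈ U ∧
    SmoothOn s U ∧ (∀ x ∈ U, proj (s x) = x) ∧
    ContMDiffOn (𝓡 P.dim) (𝓡 1) ∞ τ (proj ⁻¹' U) ∧
    ∀ p, proj p ∈ U → τ p • s (proj p) = p

attribute [instance] U1Bundle.act

/-- A smooth section over `T` of the tensor product `⨂ i, (f_i^* E)^{ε_i}` of `U(1)`-bundles, where
`E` is a `U(1)`-bundle on `B`, the `f_i : T → B` are smooth maps, and `E^{-1} = E^*` is the dual.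

A section `σ` is given by its coefficients: for `t : T` and points `p_i` of the fibres
`E_{f_i(t)}`, `σ(t) = coeff t p · ⨂ i, p_i^{ε_i}` (where `p^{-1}` denotes `p` regarded as a point of
`E^*`). Since `⨂ i, (z_i p_i)^{ε_i} = (∏ i, z_i^{ε_i}) · ⨂ i, p_i^{ε_i}`, the coefficients are
equivariant as stated. The values of `coeff t p` for other tuples `p` have no meaning. -/
structure TensorSection {B : Mfd.{u}} (E : U1Bundle B) {T : Mfd.{u}} {ι : Type} [Fintype ι]
    (f : ι → T → B) (ε : ι → ℤ) where
  coeff : T → (ι → E.P) → Circle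
  equivariant : ∀ (t : T) (p : ι → E.P), (∀ i, E.proj (p i) = f i t) → ∀ z : ι → Circle,
    coeff t (fun i => z i • p i) = (∏ i, z i ^ (-ε i)) * coeff t p
  smooth : ∀ (U : Set T) (s : ι → T → E.P), IsOpen U → (∀ i, SmoothOn (s i) U) →
    (∀ i, ∀ t ∈ U, E.proj (s i t) = f i t) →
    ContMDiffOn (𝓡 T.dim) (𝓡 1) ∞ (fun t => coeff t (fun i => s i t)) U

/-- The alternating signs `(-1)^i`. -/
def altSign {n : ℕ} (i : Fin n) : ℤ := (-1) ^ (i : ℕ)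

/-- For `σ` a section of `δE = d_0^* E ⊗ d_1^* E^* ⊗ d_2^* E` over `T` (with respect to
`f_i = d_i`), and further face maps `d_0, …, d_3 : T' → T` such that
`d_i d_{j+1} = d_j d_i` for `i ≤ j`, the section `δσ = ⨂ j, (d_j^* σ)^{(-1)^j}` of
`δ²E = ⨂ j i, ((d_i d_j)^* E)^{(-1)^(i+j)}` equals the canonical section `1`.

In `δ²E` the factor `(j+1, i)` is dual to the factor `(j', i') = (i, j)`, for `i ≤ j`; the canonical
section is `⨂ j i, (p_{j i})^{(-1)^(i+j)}` for any points with `p_{j+1, i} = p_{i, j}` for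
`i ≤ j`. -/
def TensorSection.DeltaEqOne {B : Mfd.{u}} {E : U1Bundle B} {T T' : Mfd.{u}}
    {f : Fin 3 → T → B} (σ : TensorSection E f altSign) (face : Fin 4 → T' → T) : Prop :=
  ∀ (t : T') (p : Fin 4 → Fin 3 → E.P),
    (∀ j i, E.proj (p j i) = f i (face j t)) →
    (∀ i j : Fin 3, i ≤ j → p j.succ i = p i.castSucc j) →
    ∏ j : Fin 4, σ.coeff (face j t) (p j) ^ altSign j = 1

/-- `i A` is a connection 1-form on `E` (with `u(1) = i ℝ`): `A` is smooth, `U(1)`-invariant, and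
is `1` on the generator of the action. -/
structure IsConnection {B : Mfd.{u}} (E : U1Bundle B) (A : DForm E.P 1) : Prop where
  smooth : A.IsSmooth
  invariant : ∀ z : Circle, DForm.pullback (fun p : E.P => z • p) A = A
  vertical : ∀ (p : E.P) (r : ℝ),
    A (Circle.exp r • p)
      (fun _ => mfderiv 𝓘(ℝ, ℝ) (𝓡 E.P.dim) (fun r' : ℝ => Circle.exp r' • p) r (1 : ℝ)) = 1

/-- The 1-form `η` on `T` is the pullback along the section `σ` of `⨂ i, (f_i^* E)^{ε_i}` of the
connection induced by the connection `A` on `E`: wherever `σ = g · ⨂ i, s_i^{ε_i}` for local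
sections `s_i` of `f_i^* E`, `η = g⁻¹ dg + ∑ i, ε_i s_i^* A` (up to the factor `i`). -/
def TensorSection.PullbackConnectionEq {B : Mfd.{u}} {E : U1Bundle B} {T : Mfd.{u}}
    {ι : Type} [Fintype ι] {f : ι → T → B} {ε : ι → ℤ} (σ : TensorSection E f ε)
    (A : DForm E.P 1) (η : DForm T 1) : Prop :=
  ∀ (U : Set T) (s : ι → T → E.P), IsOpen U → (∀ i, SmoothOn (s i) U) →
    (∀ i, ∀ t ∈ U, E.proj (s i t) = f i t) →
    ∀ t ∈ U, η t = DForm.dlog (fun t' => σ.coeff t' (fun i => s i t')) t +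
      ∑ i, (ε i : ℝ) • DForm.pullback (s i) A t

/-- The 2-form `F` on the base is the curvature of the connection `A`. -/
def IsCurvature {B : Mfd.{u}} (E : U1Bundle B) (A : DForm E.P 1) (F : DForm B 2) : Prop :=
  DForm.pullback E.proj F = A.d

/-! ### Bundle gerbes and rigid bundle 2-gerbes -/

/-- A bundle gerbe `(E, Z)` on `B`, for a surjective submersion `π : Z → B` with fibre powers `V`:
a `U(1)`-bundle `E` on `Z^{[2]}` and a section `m` of `δE` over `Z^{[3]}` such that `δ(m)` is the
canonical section of `δ²E` over `Z^{[4]}`. -/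
structure BundleGerbe {Z B : Mfd.{u}} {π : Z → B} (V : FibrePowers π) where
  E : U1Bundle (V.obj 1)
  m : TensorSection E (T := V.obj 2) (fun i : Fin 3 => V.face i) altSign
  assoc : m.DeltaEqOne (T' := V.obj 3) (fun j => V.face j)

/-- The underlying bisimplicial manifold: a surjective submersion `Y → X` with its Čech nerve
`C = Y^{[•+1]}`, a 4-truncated simplicial manifold `Z`, a simplicial map `Z → Y^{[•+1]}` which is a
surjective submersion in each degree, and the fibre powers `Z_n^{[k+1]}`. -/
structure SimplicialSubmersion (X : Mfd.{u}) where
  Y : Mfd.{u}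
  proj : Y → X
  proj_submersion : IsSurjSubmersion proj
  C : FibrePowers proj
  Z : TruncSimplicialMfd.{u} 4
  π : (n : ℕ) → n ≤ 4 → Z.obj n → C.obj n
  π_submersion : ∀ (n : ℕ) (hn : n ≤ 4), IsSurjSubmersion (π n hn)
  π_map : ∀ {m n : ℕ} (hm : m ≤ 4) (hn : n ≤ 4) (f : Fin (m + 1) →o Fin (n + 1)) (z : Z.obj n),
    π m hm (Z.map hm hn f z) = C.map f (π n hn z)
  V : (n : ℕ) → (hn : n ≤ 4) → FibrePowers (π n hn)

namespace SimplicialSubmersion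

variable {X : Mfd.{u}} (S : SimplicialSubmersion X)

/-- The horizontal map `Z_n^{[k+1]} → Z_m^{[k+1]}` induced by a monotone map `[m] → [n]`. -/
def hmap {m n : ℕ} (hm : m ≤ 4) (hn : n ≤ 4) (k : ℕ) (f : Fin (m + 1) →o Fin (n + 1)) :
    (S.V n hn).obj k → (S.V m hm).obj k :=
  (S.V m hm).lift (fun a w => S.Z.map hm hn f ((S.V n hn).pr k a w))
    (fun a => (S.Z.map_smooth hm hn f).comp ((S.V n hn).pr_smooth k a))
    (fun a b w => by rw [S.π_map, S.π_map, (S.V n hn).pr_eq k a b w])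

/-- The horizontal face map `d_i^h : Z_{n+1}^{[k+1]} → Z_n^{[k+1]}`. -/
def hface {n : ℕ} (hn : n + 1 ≤ 4) (k : ℕ) (i : Fin (n + 2)) :
    (S.V (n + 1) hn).obj k → (S.V n (Nat.le_of_succ_le hn)).obj k :=
  S.hmap (Nat.le_of_succ_le hn) hn k (Fin.succAboveOrderEmb i).toOrderHom

end SimplicialSubmersion

/-- A rigid bundle 2-gerbe on `X`. -/
structure RigidBundle2Gerbe (X : Mfd.{u}) extends SimplicialSubmersion X where
  /-- The bundle gerbe `(E, Z_1)` on `Y^{[2]}`, with multiplication `m`. -/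
  gerbe : BundleGerbe (toSimplicialSubmersion.V 1 (by norm_num))
  /-- The bundle 2-gerbe multiplication, a section of `δ_h E` over `Z_2^{[2]}`. -/
  M : TensorSection gerbe.E (T := (toSimplicialSubmersion.V 2 (by norm_num)).obj 1)
    (fun i : Fin 3 => toSimplicialSubmersion.hface (n := 1) (by norm_num) 1 i) altSign
  /-- `δ_v(M) = δ_h(m)` as sections of `δ_v δ_h E = δ_h δ_v E` over `Z_2^{[3]}`: the two sections
  have the same coefficient with respect to points `p a i` of `E` over `d_i^h d_a^v w`. -/
  deltaV_M : ∀ (w : (toSimplicialSubmersion.V 2 (by norm_num)).obj 2)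
    (p : Fin 3 → Fin 3 → gerbe.E.P),
    (∀ a i, gerbe.E.proj (p a i) =
      toSimplicialSubmersion.hface (n := 1) (by norm_num) 1 i
        ((toSimplicialSubmersion.V 2 (by norm_num)).face a w)) →
    ∏ a : Fin 3,
        M.coeff ((toSimplicialSubmersion.V 2 (by norm_num)).face a w) (p a) ^ altSign a =
      ∏ i : Fin 3,
        gerbe.m.coeff (toSimplicialSubmersion.hface (n := 1) (by norm_num) 2 i w)
          (fun a => p a i) ^ altSign i
  /-- `δ_h(M) = 1` as sections of `δ_h² E` over `Z_3^{[2]}`. -/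
  deltaH_M : M.DeltaEqOne (T' := (toSimplicialSubmersion.V 3 (by norm_num)).obj 1)
    (fun j => toSimplicialSubmersion.hface (n := 2) (by norm_num) 1 j)

/-! ### Connective structures -/

/-- A connective structure `(∇_E, β, λ)` on a rigid bundle 2-gerbe. Here `u(1) = i ℝ`, and all the
forms are written without the factor `i`. -/
structure ConnectiveStructure {X : Mfd.{u}} (G : RigidBundle2Gerbe X) where
  conn : DForm G.gerbe.E.P 1
  isConnection : IsConnection G.gerbe.E conn
  /-- `∇_E` is a bundle gerbe connection: `m^* δ_v ∇_E = 0`. -/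
  deltaV_conn : G.gerbe.m.PullbackConnectionEq conn 0
  β : DForm (G.Z.obj 1) 2
  β_smooth : β.IsSmooth
  /-- `δ_v β` is the curvature of `∇_E`. -/
  deltaV_β : IsCurvature G.gerbe.E conn
    (DForm.delta (fun i : Fin 2 => (G.V 1 (by norm_num)).face₀ i) β)
  /-- The 2-curving `λ`. -/
  lam : DForm G.Y 3
  lam_smooth : lam.IsSmooth
  /-- `π^* δ_h λ = d β`. -/
  deltaH_lam : DForm.pullback (G.π 1 (by norm_num))
    (DForm.delta (fun i : Fin 2 => G.C.face₀ i) lam) = β.d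

/-- A rigid connective structure `(∇_E, β, λ, α)` on a rigid bundle 2-gerbe. -/
structure RigidConnectiveStructure {X : Mfd.{u}} (G : RigidBundle2Gerbe X) extends
    ConnectiveStructure G where
  α : DForm (G.Z.obj 2) 1
  α_smooth : α.IsSmooth
  /-- `δ_v α = M^* δ_h ∇_E`. -/
  deltaV_α : G.M.PullbackConnectionEq conn
    (DForm.delta (fun i : Fin 2 => (G.V 2 (by norm_num)).face₀ i) α)
  /-- `d α = δ_h β`. -/
  d_α : α.d = DForm.delta (fun i : Fin 3 => G.Z.face (n := 1) (by norm_num) i) β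
  /-- `δ_h α = 0`. -/
  deltaH_α : DForm.delta (fun i : Fin 4 => G.Z.face (n := 2) (by norm_num) i) α = 0

end

/-!
The connective structure is built by chasing the double complex of forms on the manifolds
`Z_n^{[k+1]}`, augmented by the forms on `Y^{[n+1]}`.

The chase rests on one exactness statement: for a surjective submersion `Z → B`, the complex
`0 → Ω(B) → Ω(Z) → Ω(Z^{[2]}) → ⋯` with differential `δ` is exact. Over an open set with a local
section, inserting the section as a new first entry is an extra degeneracy and contracts the
complex, and a partition of unity on `B` glues these contractions
(`DForm.exists_delta_eq_of_extraDegeneracy`). This is applied to the maps `Z_n → Y^{[n+1]}`, which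
give the exact vertical complexes, and to `Y → X`, which gives the exactness of the complex of forms
on `Y^{[•+1]}`.

The algebraic conditions on the sections `m` and `M` enter through the forms `m^* δ_v ∇` and
`M^* δ_h ∇`. Locally such a form is `g⁻¹ dg + ∑ i, ± s_i^* A`, where `g` is the coefficient of the
section with respect to local sections `s_i` of the bundle; it is well defined since
`(z • s)^* A = s^* A + z⁻¹ dz` (`IsConnection.pullback_smul`). If `δσ = 1`, the form of `σ` is
`δ`-closed (`TensorSection.DeltaEqOne.delta_eq_zero`), an equation `δσ = δ'σ'` gives the same
equation between forms (`TensorSection.PullbackConnectionEq.delta_eq_delta`), and the exterior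
derivative of the form of `σ` is `δ` of the curvature (`TensorSection.PullbackConnectionEq.d_eq`).

Let `∇` be a connection on `E`, obtained from local trivialisations by a partition of unity.

* As `δ(m) = 1`, the form `m^* δ_v ∇` is `δ_v`-closed, hence equal to `δ_v b`; replacing `∇` by
  `∇ - b` makes it vanish.
* As `δ_v(M) = δ_h(m)`, the form `M^* δ_h ∇` is `δ_v`-closed, hence equal to `δ_v α₀`. As
  `δ_h(M) = 1`, the form `δ_h α₀` is `δ_v`-closed, so it descends to a form on `Y^{[4]}`. That form
  is `δ`-closed, since its pullback to `Z_4` is `δ_h δ_h α₀ = 0`; so it is `δτ` with `τ` on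
  `Y^{[3]}`, and `α = α₀ - π^* τ` satisfies `δ_h α = 0` without changing `δ_v α`.
* The curvature of `∇` is `δ_v`-closed, hence equal to `δ_v β₀`. The form `dα - δ_h β₀` is closed
  for `δ_v` and `δ_h`, so it is the pullback of some `δκ` on `Y^{[3]}`, and `β = β₀ + π^* κ`
  satisfies `dα = δ_h β`.
* The form `dβ` is closed for `δ_v` and `δ_h`, so it is the pullback of some `δλ` on `Y^{[2]}`.

Forms are families of alternating maps whose smoothness and exterior derivative are defined through
the preferred charts. That neither depends on the charts, and that `d` commutes with pullbacks, is
reduced to the naturality of `extDeriv` on normed spaces (`DForm.inChart_d`,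
`DForm.SmoothAt.d_pullback`).
-/

/-! ### Alternating maps on Euclidean space -/

section Euclidean

variable {X : Type*} [NormedAddCommGroup X] [NormedSpace ℝ X]

/-- A family of alternating maps on a finite-dimensional space is smooth if all its evaluations
are. -/
theorem contDiffAt_alternating_of_apply {E : Type*} [NormedAddCommGroup E] [NormedSpace ℝ E]
    [FiniteDimensional ℝ E] {k : ℕ} {f : X → E [⋀^Fin k]→L[ℝ] ℝ} {x : X}
    (h : ∀ v, ContDiffAt ℝ ∞ (fun y => f y v) x) : ContDiffAt ℝ ∞ f x := by
  let b := Module.finBasis ℝ E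
  let ev : (E [⋀^Fin k]→L[ℝ] ℝ) →L[ℝ] ((Fin k → Fin (Module.finrank ℝ E)) → ℝ) :=
    ContinuousLinearMap.pi fun v => ContinuousAlternatingMap.apply ℝ E ℝ (fun i => b (v i))
  have hev : LinearMap.ker ev.toLinearMap = ⊥ := by
    rw [LinearMap.ker_eq_bot]
    intro ω₁ ω₂ h12
    apply ContinuousAlternatingMap.toAlternatingMap_injective
    refine b.ext_alternating fun v _ => ?_
    exact congrFun h12 v
  -- A family is recovered from its values on a basis by a linear, hence continuous, left inverse.
  obtain ⟨g, hg⟩ := LinearMap.exists_leftInverse_of_injective _ hev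
  have hgf : f = fun y => LinearMap.toContinuousLinearMap g (ev (f y)) := by
    funext y
    exact (LinearMap.congr_fun hg (f y)).symm
  rw [hgf]
  refine (LinearMap.toContinuousLinearMap g).contDiff.contDiffAt.comp x ?_
  exact contDiffAt_pi.2 fun v => h _

theorem ContDiffAt.alternating_compContinuousLinearMap {E F : Type*} [NormedAddCommGroup E]
    [NormedSpace ℝ E] [FiniteDimensional ℝ E] [NormedAddCommGroup F] [NormedSpace ℝ F] {k : ℕ}
    {f : X → F [⋀^Fin k]→L[ℝ] ℝ} {g : X → E →L[ℝ] F} {x : X} (hf : ContDiffAt ℝ ∞ f x)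
    (hg : ContDiffAt ℝ ∞ g x) :
    ContDiffAt ℝ ∞ (fun y => (f y).compContinuousLinearMap (g y)) x := by
  apply contDiffAt_alternating_of_apply
  intro v
  have h1 : ContDiffAt ℝ ∞ (fun y =>
      ContinuousMultilinearMap.compContinuousLinearMapContinuousMultilinear ℝ
        (fun _ : Fin k => E) (fun _ : Fin k => F) ℝ (fun _ => g y)) x :=
    (ContinuousMultilinearMap.contDiff _).contDiffAt.comp x (contDiffAt_pi.2 fun _ => hg)
  have h2 : ContDiffAt ℝ ∞ (fun y =>
      ContinuousAlternatingMap.toContinuousMultilinearMapCLM ℝ (f y)) x :=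
    (ContinuousLinearMap.contDiff _).contDiffAt.comp x hf
  exact (ContinuousMultilinearMap.apply ℝ (fun _ : Fin k => E) ℝ v).contDiff.contDiffAt.comp x
    (h1.clm_apply h2)

theorem ContDiffAt.extDeriv {E : Type*} [NormedAddCommGroup E]
    [NormedSpace ℝ E] {k : ℕ}
    {f : E → E [⋀^Fin k]→L[ℝ] ℝ} {x : E} (hf : ContDiffAt ℝ ∞ f x) :
    ContDiffAt ℝ ∞ (extDeriv f) x :=
  (ContinuousAlternatingMap.alternatizeUncurryFinCLM ℝ E ℝ
    (n := k)).contDiff.contDiffAt.fun_comp x (hf.fderiv_right (m := ∞) (by simp))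

end Euclidean

/-! ### Local calculus of differential forms -/

theorem ContMDiffAt.eventually_mdifferentiableAt {M : Mfd.{u}} {E' H' N : Type*}
    [NormedAddCommGroup E'] [NormedSpace ℝ E'] [TopologicalSpace H'] {I' : ModelWithCorners ℝ E' H'}
    [TopologicalSpace N] [ChartedSpace H' N] [IsManifold I' ∞ N] {f : M → N} {x : M}
    (hf : ContMDiffAt (𝓡 M.dim) I' ∞ f x) :
    ∀ᶠ y in 𝓝 x, MDifferentiableAt (𝓡 M.dim) I' f y := by
  have : IsManifold I' 1 N := IsManifold.of_le (n := ∞) (by simp)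
  have : IsManifold (𝓡 M.dim) 1 M := IsManifold.of_le (n := ∞) (by simp)
  have h1 : ContMDiffAt (𝓡 M.dim) I' 1 f x := hf.of_le (by simp)
  filter_upwards [(contMDiffAt_iff_contMDiffAt_nhds (by simp)).1 h1] with y hy
  exact hy.mdifferentiableAt (by simp)

namespace DForm

variable {M N L : Mfd.{u}} {k : ℕ}

/-- The chart of `M` at `x`, with the model space written out. -/
noncomputable abbrev ch (x : M) : OpenPartialHomeomorph M (EuclideanSpace ℝ (Fin M.dim)) :=
  chartAt (EuclideanSpace ℝ (Fin M.dim)) x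

/-- Smoothness of a form at a point, tested in the preferred chart at that point. -/
def SmoothAt (η : DForm M k) (x : M) : Prop :=
  ContDiffAt ℝ ∞ (η.inChart x) (ch x x)

theorem contMDiffAt_ch {x₀ x : M} (hx : x ∈ (ch x₀).source) :
    ContMDiffAt (𝓡 M.dim) (𝓡 M.dim) ∞ (ch x₀) x :=
  (contMDiffOn_chart x hx).contMDiffAt ((ch x₀).open_source.mem_nhds hx)

theorem contMDiffAt_ch_symm {x₀ : M} {y : EuclideanSpace ℝ (Fin M.dim)}
    (hy : y ∈ (ch x₀).target) :
    ContMDiffAt (𝓡 M.dim) (𝓡 M.dim) ∞ (ch x₀).symm y :=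
  (contMDiffOn_chart_symm y hy).contMDiffAt ((ch x₀).open_target.mem_nhds hy)

theorem mdifferentiableAt_ch {x₀ x : M} (hx : x ∈ (ch x₀).source) :
    MDifferentiableAt (𝓡 M.dim) (𝓡 M.dim) (ch x₀) x :=
  (contMDiffAt_ch hx).mdifferentiableAt (by simp)

theorem mdifferentiableAt_ch_symm {x₀ : M} {y : EuclideanSpace ℝ (Fin M.dim)}
    (hy : y ∈ (ch x₀).target) :
    MDifferentiableAt (𝓡 M.dim) (𝓡 M.dim) (ch x₀).symm y :=
  (contMDiffAt_ch_symm hy).mdifferentiableAt (by simp)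

theorem inChart_congr {η η' : DForm M k} {x₀ x : M} (hx : x ∈ (ch x₀).source)
    (h : ∀ᶠ y in 𝓝 x, η y = η' y) : η.inChart x₀ =ᶠ[𝓝 (ch x₀ x)] η'.inChart x₀ := by
  have hc : ContinuousAt (ch x₀).symm (ch x₀ x) :=
    (ch x₀).continuousAt_symm ((ch x₀).map_source hx)
  have h' : ∀ᶠ y in 𝓝 ((ch x₀).symm (ch x₀ x)), η y = η' y := by rwa [(ch x₀).left_inv hx]
  filter_upwards [hc.eventually h'] with y hy
  simp only [inChart]
  rw [hy]

/-- A map in the charts at `x₀` and `x₁`. -/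
noncomputable def localMap (f : M → N) (x₀ : M) (x₁ : N) :
    EuclideanSpace ℝ (Fin M.dim) → EuclideanSpace ℝ (Fin N.dim) :=
  ch x₁ ∘ f ∘ (ch x₀).symm

theorem contDiffAt_localMap {f : M → N} {x₀ x : M} {x₁ : N} (hx : x ∈ (ch x₀).source)
    (hfx : f x ∈ (ch x₁).source) (hf : ContMDiffAt (𝓡 M.dim) (𝓡 N.dim) ∞ f x) :
    ContDiffAt ℝ ∞ (localMap f x₀ x₁) (ch x₀ x) := by
  rw [← contMDiffAt_iff_contDiffAt]
  have hx' : (ch x₀).symm (ch x₀ x) = x := (ch x₀).left_inv hx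
  refine ContMDiffAt.comp (I' := 𝓡 N.dim) (ch x₀ x) ?_
    (ContMDiffAt.comp (I' := 𝓡 M.dim) (ch x₀ x) ?_ ?_)
  · apply contMDiffAt_ch
    simpa [hx'] using hfx
  · rwa [hx']
  · exact contMDiffAt_ch_symm ((ch x₀).map_source hx)

/-- In charts, the pullback of forms is the pullback of forms on Euclidean space. -/
theorem inChart_pullback {f : M → N} {x₀ x : M} {x₁ : N} (hx : x ∈ (ch x₀).source)
    (hfx : f x ∈ (ch x₁).source) (hf : ContMDiffAt (𝓡 M.dim) (𝓡 N.dim) ∞ f x)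
    (η : DForm N k) :
    (pullback f η).inChart x₀ =ᶠ[𝓝 (ch x₀ x)] fun y =>
      (η.inChart x₁ (localMap f x₀ x₁ y)).compContinuousLinearMap
        (fderiv ℝ (localMap f x₀ x₁) y) := by
  have hx' : (ch x₀).symm (ch x₀ x) = x := (ch x₀).left_inv hx
  have hc : ContinuousAt (ch x₀).symm (ch x₀ x) :=
    (ch x₀).continuousAt_symm ((ch x₀).map_source hx)
  have hfc : ∀ᶠ z in 𝓝 x, f z ∈ (ch x₁).source :=
    hf.continuousAt.eventually ((ch x₁).open_source.mem_nhds hfx)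
  have e1 : ∀ᶠ y in 𝓝 (ch x₀ x), MDifferentiableAt (𝓡 M.dim) (𝓡 N.dim) f ((ch x₀).symm y) :=
    hc.eventually (by rw [hx']; exact hf.eventually_mdifferentiableAt)
  have e2 : ∀ᶠ y in 𝓝 (ch x₀ x), f ((ch x₀).symm y) ∈ (ch x₁).source :=
    hc.eventually (by rwa [hx'])
  have e3 : ∀ᶠ y in 𝓝 (ch x₀ x), y ∈ (ch x₀).target :=
    (ch x₀).open_target.mem_nhds ((ch x₀).map_source hx)
  filter_upwards [e1, e2.eventually_nhds, e3] with y h1 h2' h3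
  have h2 := h2'.self_of_nhds
  have hl : (ch x₁).symm (localMap f x₀ x₁ y) = f ((ch x₀).symm y) := (ch x₁).left_inv h2
  have hd0 : MDifferentiableAt (𝓡 M.dim) (𝓡 N.dim) (f ∘ (ch x₀).symm) y :=
    h1.comp y (mdifferentiableAt_ch_symm h3)
  have hd1 : MDifferentiableAt (𝓡 M.dim) (𝓡 N.dim) (localMap f x₀ x₁) y :=
    (mdifferentiableAt_ch h2).comp y hd0
  have hd2 : MDifferentiableAt (𝓡 N.dim) (𝓡 N.dim) (ch x₁).symm (localMap f x₀ x₁ y) :=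
    mdifferentiableAt_ch_symm ((ch x₁).map_source h2)
  have key : (ch x₁).symm ∘ localMap f x₀ x₁ =ᶠ[𝓝 y] f ∘ (ch x₀).symm := by
    filter_upwards [h2'] with z hz using (ch x₁).left_inv hz
  have c1 := mfderiv_comp y hd2 hd1
  have c2 := mfderiv_comp y h1 (mdifferentiableAt_ch_symm h3)
  rw [key.mfderiv_eq, c2, mfderiv_eq_fderiv] at c1
  ext v
  simp only [inChart, pullback, ContinuousAlternatingMap.compContinuousLinearMap_apply]
  have c3 : ∀ w : EuclideanSpace ℝ (Fin M.dim),
      mfderiv (𝓡 M.dim) (𝓡 N.dim) f ((ch x₀).symm y)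
        (mfderiv (𝓡 M.dim) (𝓡 M.dim) (ch x₀).symm y w) =
      mfderiv (𝓡 N.dim) (𝓡 N.dim) (ch x₁).symm (localMap f x₀ x₁ y)
        (fderiv ℝ (localMap f x₀ x₁) y w) := fun w => congrArg (fun φ => φ w) c1
  -- The tangent spaces at different points are all the model space, so that vectors at `a` may be
  -- inserted into a form at `b`.
  have aux : ∀ (a b : N) (_ : a = b) (v v' : Fin k → EuclideanSpace ℝ (Fin N.dim)) (_ : v = v'),
      (η a : EuclideanSpace ℝ (Fin N.dim) [⋀^Fin k]→L[ℝ] ℝ) v = η b v' := by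
    rintro a _ rfl v _ rfl; rfl
  exact aux _ _ hl.symm _ _ (funext fun i => c3 (v i))

end DForm

theorem minSmoothness_two_le_infty : minSmoothness ℝ 2 ≤ ∞ := by
  rw [minSmoothness_of_isRCLikeNormedField]
  exact WithTop.coe_le_coe.2 le_top

namespace DForm

variable {M N L : Mfd.{u}} {k : ℕ}

theorem pullback_id (η : DForm M k) : pullback id η = η := by
  funext x
  ext v
  simp only [pullback, mfderiv_id, ContinuousAlternatingMap.compContinuousLinearMap_apply]
  rfl

theorem contDiffAt_inChart_pullback {f : M → N} {x₀ x : M} {x₁ : N} (hx : x ∈ (ch x₀).source)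
    (hfx : f x ∈ (ch x₁).source) (hf : ContMDiffAt (𝓡 M.dim) (𝓡 N.dim) ∞ f x)
    {η : DForm N k} (hη : ContDiffAt ℝ ∞ (η.inChart x₁) (ch x₁ (f x))) :
    ContDiffAt ℝ ∞ ((pullback f η).inChart x₀) (ch x₀ x) := by
  have hF := contDiffAt_localMap hx hfx hf
  have hl : localMap f x₀ x₁ (ch x₀ x) = ch x₁ (f x) := by
    simp [localMap, (ch x₀).left_inv hx]
  refine ContDiffAt.congr_of_eventuallyEq ?_ (inChart_pullback hx hfx hf η)
  refine ContDiffAt.alternating_compContinuousLinearMap (f := fun y => η.inChart x₁ _) ?_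
    (hF.fderiv_right (m := ∞) (by simp))
  refine ContDiffAt.fun_comp (ch x₀ x) (g := η.inChart x₁) ?_ hF
  rwa [hl]

/-- Smoothness at a point may be tested in any chart around it: a change of charts is the pullback
along the identity. -/
theorem smoothAt_iff {η : DForm M k} {x₀ x : M} (hx : x ∈ (ch x₀).source) :
    η.SmoothAt x ↔ ContDiffAt ℝ ∞ (η.inChart x₀) (ch x₀ x) := by
  have hid : ContMDiffAt (𝓡 M.dim) (𝓡 M.dim) ∞ (id : M → M) x := contMDiffAt_id
  constructor
  · intro h
    have := contDiffAt_inChart_pullback (x₁ := x) hx (mem_chart_source _ x) hid (η := η) h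
    rwa [pullback_id] at this
  · intro h
    have := contDiffAt_inChart_pullback (x₁ := x₀) (mem_chart_source _ x) hx hid (η := η) h
    rwa [pullback_id] at this

theorem isSmooth_iff {η : DForm M k} : η.IsSmooth ↔ ∀ x, η.SmoothAt x := by
  constructor
  · intro h x
    exact (h x).contDiffAt ((ch x).open_target.mem_nhds (mem_chart_target _ x))
  · intro h x₀ y hy
    have hx : (ch x₀).symm y ∈ (ch x₀).source := (ch x₀).map_target hy
    have := (smoothAt_iff hx).1 (h _)
    rw [(ch x₀).right_inv hy] at this
    exact this.contDiffWithinAt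

theorem SmoothAt.congr {η η' : DForm M k} {x : M} (h : η.SmoothAt x)
    (e : ∀ᶠ y in 𝓝 x, η' y = η y) : η'.SmoothAt x :=
  ContDiffAt.congr_of_eventuallyEq h (inChart_congr (mem_chart_source _ x) e)

theorem SmoothAt.pullback {f : M → N} {x : M} {η : DForm N k} (hη : η.SmoothAt (f x))
    (hf : ContMDiffAt (𝓡 M.dim) (𝓡 N.dim) ∞ f x) : (η.pullback f).SmoothAt x :=
  contDiffAt_inChart_pullback (mem_chart_source _ x) (mem_chart_source _ (f x)) hf hη

theorem IsSmooth.pullback {f : M → N} {η : DForm N k} (hη : η.IsSmooth) (hf : Smooth f) :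
    (η.pullback f).IsSmooth :=
  isSmooth_iff.2 fun x => (isSmooth_iff.1 hη (f x)).pullback (hf x)

theorem pullback_congr {f g : M → N} {x : M} (h : f =ᶠ[𝓝 x] g) (η : DForm N k) :
    pullback f η x = pullback g η x := by
  have aux : ∀ (a b : N) (_ : a = b) (v v' : Fin k → EuclideanSpace ℝ (Fin N.dim)) (_ : v = v'),
      (η a : EuclideanSpace ℝ (Fin N.dim) [⋀^Fin k]→L[ℝ] ℝ) v = η b v' := by
    rintro a _ rfl v _ rfl; rfl
  ext v
  simp only [pullback, ContinuousAlternatingMap.compContinuousLinearMap_apply]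
  refine aux _ _ h.self_of_nhds _ _ (funext fun i => ?_)
  exact congrArg (fun φ : EuclideanSpace ℝ (Fin M.dim) →L[ℝ] EuclideanSpace ℝ (Fin N.dim) =>
    φ (v i)) h.mfderiv_eq

theorem pullback_pullback {f : M → N} {g : N → L} {x : M}
    (hg : MDifferentiableAt (𝓡 N.dim) (𝓡 L.dim) g (f x))
    (hf : MDifferentiableAt (𝓡 M.dim) (𝓡 N.dim) f x) (η : DForm L k) :
    pullback f (pullback g η) x = pullback (g ∘ f) η x := by
  ext v
  simp only [pullback, ContinuousAlternatingMap.compContinuousLinearMap_apply, mfderiv_comp x hg hf]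
  rfl

theorem pullback_pullback' {f : M → N} {g : N → L} (hg : Smooth g) (hf : Smooth f)
    (η : DForm L k) : pullback f (pullback g η) = pullback (g ∘ f) η :=
  funext fun x => pullback_pullback ((hg (f x)).mdifferentiableAt (by simp))
    ((hf x).mdifferentiableAt (by simp)) η

/-- A pullback at a point only depends on the form at the image point. -/
theorem pullback_apply_congr {f : M → N} {x : M} {η η' : DForm N k} (h : η (f x) = η' (f x)) :
    pullback f η x = pullback f η' x := by
  simp only [pullback, h]

/-! #### Linear operations -/

@[simp] theorem pullback_add (f : M → N) (η η' : DForm N k) :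
    pullback f (η + η') = pullback f η + pullback f η' := rfl

@[simp] theorem pullback_smul (f : M → N) (c : ℝ) (η : DForm N k) :
    pullback f (c • η) = c • pullback f η := rfl

@[simp] theorem pullback_zero (f : M → N) : pullback f (0 : DForm N k) = 0 := rfl

@[simp] theorem pullback_sub (f : M → N) (η η' : DForm N k) :
    pullback f (η - η') = pullback f η - pullback f η' := rfl

@[simp] theorem pullback_sum {ι : Type*} (f : M → N) (s : Finset ι) (η : ι → DForm N k) :
    pullback f (∑ i ∈ s, η i) = ∑ i ∈ s, pullback f (η i) :=
  map_sum (⟨⟨pullback f, rfl⟩, pullback_add f⟩ : DForm N k →+ DForm M k) η s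

theorem inChart_add (η η' : DForm M k) (x : M) :
    (η + η').inChart x = η.inChart x + η'.inChart x := rfl

theorem inChart_smul (c : ℝ) (η : DForm M k) (x : M) :
    (c • η).inChart x = c • η.inChart x := rfl

theorem SmoothAt.add {η η' : DForm M k} {x : M} (h : η.SmoothAt x) (h' : η'.SmoothAt x) :
    (η + η').SmoothAt x := ContDiffAt.add h h'

theorem SmoothAt.const_smul {η : DForm M k} {x : M} (c : ℝ) (h : η.SmoothAt x) :
    (c • η).SmoothAt x := ContDiffAt.const_smul c h

theorem smoothAt_zero (x : M) : (0 : DForm M k).SmoothAt x :=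
  contDiffAt_const (c := (0 : EuclideanSpace ℝ (Fin M.dim) [⋀^Fin k]→L[ℝ] ℝ))

theorem SmoothAt.sum {ι : Type*} {s : Finset ι} {η : ι → DForm M k} {x : M}
    (h : ∀ i ∈ s, (η i).SmoothAt x) : (∑ i ∈ s, η i).SmoothAt x := by
  classical
  induction s using Finset.induction_on with
  | empty => simpa using smoothAt_zero x
  | insert i s hi ih =>
    rw [Finset.sum_insert hi]
    exact (h i (by simp)).add (ih fun j hj => h j (by simp [hj]))

theorem SmoothAt.sub {η η' : DForm M k} {x : M} (h : η.SmoothAt x) (h' : η'.SmoothAt x) :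
    (η - η').SmoothAt x := ContDiffAt.sub h h'

/-- Multiplication of a form by a function. -/
theorem SmoothAt.fun_smul {η : DForm M k} {x : M} (h : η.SmoothAt x) {c : M → ℝ}
    (hc : ContMDiffAt (𝓡 M.dim) 𝓘(ℝ, ℝ) ∞ c x) :
    SmoothAt (fun y => c y • η y : DForm M k) x := by
  have h1 : ContDiffAt ℝ ∞ (c ∘ (ch x).symm) (ch x x) := by
    rw [← contMDiffAt_iff_contDiffAt]
    refine ContMDiffAt.comp (I' := 𝓡 M.dim) (ch x x) ?_
      (contMDiffAt_ch_symm (mem_chart_target _ x))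
    rwa [(ch x).left_inv (mem_chart_source _ x)]
  exact ContDiffAt.smul h1 h

/-! #### The exterior derivative -/

theorem SmoothAt.eventually_differentiableAt {η : DForm M k} {x : M} (h : η.SmoothAt x) :
    ∀ᶠ y in 𝓝 (ch x x), DifferentiableAt ℝ (η.inChart x) y := by
  have h1 : ContDiffAt ℝ 1 (η.inChart x) (ch x x) := ContDiffAt.of_le h (by simp)
  filter_upwards [h1.eventually (by simp)] with y hy using hy.differentiableAt (by simp)

theorem SmoothAt.differentiableAt {η : DForm M k} {x : M} (h : η.SmoothAt x) :
    DifferentiableAt ℝ (η.inChart x) (ch x x) := ContDiffAt.differentiableAt h (by simp)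

theorem d_congr {η η' : DForm M k} {x : M} (h : ∀ᶠ y in 𝓝 x, η y = η' y) : η.d x = η'.d x := by
  simp only [d]
  rw [(inChart_congr (mem_chart_source _ x) h).extDeriv_eq]

/-- The exterior derivative, defined at `x` by the chart at `x`, may be computed in the chart at any
`x₀`: on Euclidean space it commutes with the pullback along the change of charts. -/
theorem inChart_d {η : DForm M k} {x₀ x : M} (hx : x ∈ (ch x₀).source)
    (h : DifferentiableAt ℝ (η.inChart x₀) (ch x₀ x)) :
    η.d.inChart x₀ (ch x₀ x) = extDeriv (η.inChart x₀) (ch x₀ x) := by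
  have hid : ContMDiffAt (𝓡 M.dim) (𝓡 M.dim) ∞ (id : M → M) x := contMDiffAt_id
  have hxx : x ∈ (ch x).source := mem_chart_source _ x
  have hx' : (ch x₀).symm (ch x₀ x) = x := (ch x₀).left_inv hx
  have e := inChart_pullback hxx (x₁ := x₀) hx hid η
  rw [pullback_id] at e
  have hF := contDiffAt_localMap hxx (x₁ := x₀) hx hid
  have hl : localMap id x x₀ (ch x x) = ch x₀ x := by
    simp [localMap, (ch x).left_inv hxx]
  have e2 : extDeriv (η.inChart x) (ch x x) = _ :=
    e.extDeriv_eq.trans (extDeriv_pullback (by rwa [hl]) hF minSmoothness_two_le_infty)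
  rw [hl] at e2
  -- What remains are the derivatives of the change of charts, of the chart at `x` and of the
  -- inverse of the chart at `x₀`, which compose to the identity.
  have key : localMap id x x₀ ∘ (ch x) ∘ (ch x₀).symm =ᶠ[𝓝 (ch x₀ x)] id := by
    have hc : ContinuousAt (ch x₀).symm (ch x₀ x) :=
      (ch x₀).continuousAt_symm ((ch x₀).map_source hx)
    filter_upwards [(ch x₀).open_target.mem_nhds ((ch x₀).map_source hx),
      hc.eventually ((ch x).open_source.mem_nhds (by rwa [hx']))] with y hy hy'
    simp [localMap, (ch x).left_inv hy', (ch x₀).right_inv hy]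
  have d1 := mdifferentiableAt_ch_symm ((ch x₀).map_source hx)
  have d2 : MDifferentiableAt (𝓡 M.dim) (𝓡 M.dim) (ch x) ((ch x₀).symm (ch x₀ x)) := by
    rw [hx']; exact mdifferentiableAt_ch hxx
  have d3 : MDifferentiableAt (𝓡 M.dim) (𝓡 M.dim) (localMap id x x₀)
      (((ch x) ∘ (ch x₀).symm) (ch x₀ x)) := by
    simp only [Function.comp, hx']
    exact (contMDiffAt_iff_contDiffAt.2 hF).mdifferentiableAt (by simp)
  have c1 := mfderiv_comp (ch x₀ x) d3 (d2.comp _ d1)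
  rw [key.mfderiv_eq, mfderiv_comp (ch x₀ x) d2 d1, mfderiv_id] at c1
  simp only [Function.comp, hx', mfderiv_eq_fderiv] at c1
  ext v
  have aux : ∀ (a b : M) (_ : a = b) (v v' : Fin (k + 1) → EuclideanSpace ℝ (Fin M.dim))
      (_ : v = v'),
      (η.d a : EuclideanSpace ℝ (Fin M.dim) [⋀^Fin (k + 1)]→L[ℝ] ℝ) v = η.d b v' := by
    rintro a _ rfl v _ rfl; rfl
  refine (aux _ _ hx' _ _ rfl).trans ?_
  refine (congrArg (fun (ζ : EuclideanSpace ℝ (Fin M.dim) [⋀^Fin (k + 1)]→L[ℝ] ℝ) => ζ _)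
    e2).trans ?_
  have hbase : ∀ (a b : M) (_ : a = b) (w : EuclideanSpace ℝ (Fin M.dim)),
      (mfderiv (𝓡 M.dim) (𝓡 M.dim) (ch x) a w : EuclideanSpace ℝ (Fin M.dim)) =
        mfderiv (𝓡 M.dim) (𝓡 M.dim) (ch x) b w := by
    rintro a _ rfl w; rfl
  exact congrArg (extDeriv (η.inChart x₀) (ch x₀ x)) (funext fun i =>
    (congrArg (fderiv ℝ (localMap id x x₀) (ch x x)) (hbase _ _ hx'.symm _)).trans
      (congrArg (fun φ : EuclideanSpace ℝ (Fin M.dim) →L[ℝ] EuclideanSpace ℝ (Fin M.dim) =>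
        φ (v i)) c1).symm)

theorem SmoothAt.inChart_d_eventuallyEq {η : DForm M k} {x : M} (h : η.SmoothAt x) :
    η.d.inChart x =ᶠ[𝓝 (ch x x)] extDeriv (η.inChart x) := by
  filter_upwards [h.eventually_differentiableAt,
    (ch x).open_target.mem_nhds (mem_chart_target _ x)] with y hy hy'
  have := inChart_d ((ch x).map_target hy') (by rwa [(ch x).right_inv hy'])
  rwa [(ch x).right_inv hy'] at this

theorem SmoothAt.d {η : DForm M k} {x : M} (h : η.SmoothAt x) : η.d.SmoothAt x :=
  ContDiffAt.congr_of_eventuallyEq (ContDiffAt.extDeriv h) h.inChart_d_eventuallyEq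

theorem IsSmooth.d {η : DForm M k} (h : η.IsSmooth) : η.d.IsSmooth :=
  isSmooth_iff.2 fun x => (isSmooth_iff.1 h x).d

theorem SmoothAt.d_d {η : DForm M k} {x : M} (h : η.SmoothAt x) : η.d.d x = 0 := by
  have : extDeriv (η.d.inChart x) (ch x x) = 0 := by
    rw [h.inChart_d_eventuallyEq.extDeriv_eq]
    exact extDeriv_extDeriv_apply h minSmoothness_two_le_infty
  change (extDeriv (η.d.inChart x) (ch x x)).compContinuousLinearMap _ = 0
  rw [this]
  rfl

theorem SmoothAt.d_pullback {f : M → N} {x : M} {η : DForm N k} (hη : η.SmoothAt (f x))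
    (hf : ContMDiffAt (𝓡 M.dim) (𝓡 N.dim) ∞ f x) : (η.pullback f).d x = η.d.pullback f x := by
  have hxx : x ∈ (ch x).source := mem_chart_source _ x
  have hfx : f x ∈ (ch (f x)).source := mem_chart_source _ _
  have hF := contDiffAt_localMap hxx hfx hf
  have hl : localMap f x (f x) (ch x x) = ch (f x) (f x) := by
    simp [localMap, (ch x).left_inv hxx]
  have e2 : extDeriv ((η.pullback f).inChart x) (ch x x) = _ :=
    (inChart_pullback hxx hfx hf η).extDeriv_eq.trans
      (extDeriv_pullback (by rw [hl]; exact hη.differentiableAt) hF minSmoothness_two_le_infty)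
  rw [hl] at e2
  have key : localMap f x (f x) ∘ (ch x) =ᶠ[𝓝 x] ch (f x) ∘ f := by
    filter_upwards [(ch x).open_source.mem_nhds hxx] with y hy
    simp [localMap, (ch x).left_inv hy]
  have c1 := mfderiv_comp x ((contMDiffAt_iff_contDiffAt.2 hF).mdifferentiableAt (by simp))
    (mdifferentiableAt_ch hxx)
  rw [key.mfderiv_eq, mfderiv_comp x (mdifferentiableAt_ch hfx) (hf.mdifferentiableAt (by simp)),
    mfderiv_eq_fderiv] at c1
  ext v
  refine (congrArg (fun (ζ : EuclideanSpace ℝ (Fin M.dim) [⋀^Fin (k + 1)]→L[ℝ] ℝ) => ζ _)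
    e2).trans ?_
  exact congrArg (extDeriv (η.inChart (f x)) (ch (f x) (f x))) (funext fun i =>
    (congrArg (fun φ : EuclideanSpace ℝ (Fin M.dim) →L[ℝ] EuclideanSpace ℝ (Fin N.dim) =>
      φ (v i)) c1).symm)

theorem IsSmooth.d_pullback {f : M → N} {η : DForm N k} (hη : η.IsSmooth) (hf : Smooth f) :
    (η.pullback f).d = η.d.pullback f :=
  funext fun x => (isSmooth_iff.1 hη (f x)).d_pullback (hf x)

theorem SmoothAt.d_add {η η' : DForm M k} {x : M} (h : η.SmoothAt x) (h' : η'.SmoothAt x) :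
    (η + η').d x = η.d x + η'.d x := by
  simp only [DForm.d, inChart_add]
  rw [extDeriv_add h.differentiableAt h'.differentiableAt]
  rfl

theorem d_smul (c : ℝ) (η : DForm M k) : (c • η).d = c • η.d := by
  funext x
  simp only [DForm.d, inChart_smul, extDeriv_smul]
  rfl

@[simp] theorem d_zero : (0 : DForm M k).d = 0 := by
  have := d_smul 0 (0 : DForm M k)
  simpa using this

theorem SmoothAt.d_sum {ι : Type*} {s : Finset ι} {η : ι → DForm M k} {x : M}
    (h : ∀ i ∈ s, (η i).SmoothAt x) : (∑ i ∈ s, η i).d x = ∑ i ∈ s, (η i).d x := by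
  classical
  induction s using Finset.induction_on with
  | empty => simp
  | insert i s hi ih =>
    rw [Finset.sum_insert hi, Finset.sum_insert hi,
      (h i (by simp)).d_add (SmoothAt.sum fun j hj => h j (by simp [hj])),
      ih fun j hj => h j (by simp [hj])]

theorem SmoothAt.d_sub {η η' : DForm M k} {x : M} (h : η.SmoothAt x) (h' : η'.SmoothAt x) :
    (η - η').d x = η.d x - η'.d x := by
  have e : ∀ {l : ℕ} (ζ ζ' : DForm M l), ζ - ζ' = ζ + (-1 : ℝ) • ζ' := fun ζ ζ' => by
    funext y
    ext v
    change ζ y v - ζ' y v = ζ y v + (-1 : ℝ) * ζ' y v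
    ring
  rw [e, h.d_add (h'.const_smul _), d_smul]
  exact (congrFun (e η.d η'.d) x).symm

end DForm

/-! ### Alternating sums over faces -/

/-- The cancellation behind `δ² = 0`: the terms of a double alternating sum indexed by pairs of
faces cancel in pairs if they satisfy the simplicial identities. -/
theorem sum_sum_alternating_eq_zero {G : Type*} [AddCommGroup G] [Module ℝ G] {n : ℕ}
    (x : Fin (n + 2) → Fin (n + 1) → G)
    (h : ∀ i j : Fin (n + 1), i ≤ j → x j.succ i = x i.castSucc j) :
    ∑ j : Fin (n + 2), (-1 : ℝ) ^ (j : ℕ) • ∑ i : Fin (n + 1), (-1 : ℝ) ^ (i : ℕ) • x j i = 0 := by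
  simp only [Finset.smul_sum, smul_smul]
  rw [← Finset.sum_product', Finset.univ_product_univ,
    ← Finset.sum_filter_add_sum_filter_not Finset.univ
      (fun p : Fin (n + 2) × Fin (n + 1) => p.1 ≤ p.2.castSucc), ← eq_neg_iff_add_eq_zero,
    ← Finset.sum_neg_distrib]
  refine Finset.sum_bij'
    (fun p hp => (p.2.succ, p.1.castLT (by
      have h1 := (Finset.mem_filter.1 hp).2
      have h2 := p.2.isLt
      rw [Fin.le_def, Fin.val_castSucc] at h1
      omega)))
    (fun p hp => (p.2.castSucc, p.1.pred (by
      have h1 := (Finset.mem_filter.1 hp).2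
      rw [Fin.le_def, Fin.val_castSucc] at h1
      rintro h2
      rw [h2] at h1
      simp at h1)))
    ?_ ?_ ?_ ?_ ?_
  · intro p hp
    have h1 := (Finset.mem_filter.1 hp).2
    simp only [Fin.le_def, Fin.val_castSucc] at h1
    simp [Fin.le_def]
    omega
  · intro p hp
    have h1 := (Finset.mem_filter.1 hp).2
    simp only [Fin.le_def, Fin.val_castSucc] at h1
    simp [Fin.le_def]
    omega
  · intro p hp
    simp
  · intro p hp
    simp
  · intro p hp
    have h1 := (Finset.mem_filter.1 hp).2
    simp only [Fin.le_def, Fin.val_castSucc] at h1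
    have h2 := h (p.1.castLT (by have := p.2.isLt; omega)) p.2 (by simpa [Fin.le_def] using h1)
    simp only [Fin.castSucc_castLT] at h2
    rw [h2, ← neg_smul]
    congr 1
    simp [pow_succ, mul_comm]

namespace DForm

variable {L M N B : Mfd.{u}} {k : ℕ}

/-! ### The simplicial differential of forms -/

theorem delta_apply {n : ℕ} (f : Fin (n + 1) → M → N) (η : DForm N k) (x : M) :
    delta f η x = ∑ i : Fin (n + 1), (-1 : ℝ) ^ (i : ℕ) • pullback (f i) η x := by
  simp [delta, Finset.sum_apply]

theorem delta_sub {n : ℕ} (f : Fin (n + 1) → M → N) (η η' : DForm N k) :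
    delta f (η - η') = delta f η - delta f η' := by
  simp [delta, smul_sub, Finset.sum_sub_distrib]

theorem delta_add {n : ℕ} (f : Fin (n + 1) → M → N) (η η' : DForm N k) :
    delta f (η + η') = delta f η + delta f η' := by
  simp [delta, smul_add, Finset.sum_add_distrib]

@[simp] theorem delta_zero {n : ℕ} (f : Fin (n + 1) → M → N) :
    delta f (0 : DForm N k) = 0 := by
  simp [delta]

theorem IsSmooth.delta {n : ℕ} {f : Fin (n + 1) → M → N} {η : DForm N k} (hη : η.IsSmooth)
    (hf : ∀ i, Smooth (f i)) : (delta f η).IsSmooth :=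
  isSmooth_iff.2 fun x => SmoothAt.sum fun i _ =>
    (isSmooth_iff.1 (hη.pullback (hf i)) x).const_smul _

theorem IsSmooth.sub {η η' : DForm M k} (hη : η.IsSmooth) (hη' : η'.IsSmooth) :
    (η - η').IsSmooth :=
  isSmooth_iff.2 fun x => (isSmooth_iff.1 hη x).sub (isSmooth_iff.1 hη' x)

theorem IsSmooth.add {η η' : DForm M k} (hη : η.IsSmooth) (hη' : η'.IsSmooth) :
    (η + η').IsSmooth :=
  isSmooth_iff.2 fun x => (isSmooth_iff.1 hη x).add (isSmooth_iff.1 hη' x)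

theorem IsSmooth.d_d {η : DForm M k} (hη : η.IsSmooth) : η.d.d = 0 :=
  funext fun x => (isSmooth_iff.1 hη x).d_d

theorem IsSmooth.d_sub {η η' : DForm M k} (hη : η.IsSmooth) (hη' : η'.IsSmooth) :
    (η - η').d = η.d - η'.d :=
  funext fun x => (isSmooth_iff.1 hη x).d_sub (isSmooth_iff.1 hη' x)

theorem IsSmooth.d_add {η η' : DForm M k} (hη : η.IsSmooth) (hη' : η'.IsSmooth) :
    (η + η').d = η.d + η'.d :=
  funext fun x => (isSmooth_iff.1 hη x).d_add (isSmooth_iff.1 hη' x)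

theorem IsSmooth.d_delta {n : ℕ} {f : Fin (n + 1) → M → N} {η : DForm N k} (hη : η.IsSmooth)
    (hf : ∀ i, Smooth (f i)) : (DForm.delta f η).d = DForm.delta f η.d := by
  funext x
  rw [DForm.delta, SmoothAt.d_sum fun i _ =>
    (isSmooth_iff.1 (hη.pullback (hf i)) x).const_smul _, delta_apply]
  refine Finset.sum_congr rfl fun i _ => ?_
  rw [d_smul, hη.d_pullback (hf i)]
  rfl

theorem delta_delta {n : ℕ} {f : Fin (n + 1) → M → N} {g : Fin (n + 2) → L → M}
    (hf : ∀ i, Smooth (f i)) (hg : ∀ i, Smooth (g i))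
    (h : ∀ i j : Fin (n + 1), i ≤ j → f i ∘ g j.succ = f j ∘ g i.castSucc) (η : DForm N k) :
    delta g (delta f η) = 0 := by
  have := sum_sum_alternating_eq_zero (fun j i => pullback (f i ∘ g j) η)
    (fun i j hij => by rw [h i j hij])
  simpa only [delta, pullback_sum, pullback_smul, pullback_pullback' (hf _) (hg _)] using this

theorem delta_comm {m n : ℕ} {M' : Mfd.{u}} {f : Fin (n + 1) → M → N} {g : Fin (m + 1) → L → M}
    {f' : Fin (n + 1) → L → M'} {g' : Fin (m + 1) → M' → N}
    (hf : ∀ i, Smooth (f i)) (hg : ∀ i, Smooth (g i)) (hf' : ∀ i, Smooth (f' i))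
    (hg' : ∀ i, Smooth (g' i)) (h : ∀ i a, f i ∘ g a = g' a ∘ f' i) (η : DForm N k) :
    delta g (delta f η) = delta f' (delta g' η) := by
  simp only [delta, pullback_sum, pullback_smul, pullback_pullback' (hf _) (hg _),
    pullback_pullback' (hg' _) (hf' _), h, Finset.smul_sum]
  rw [Finset.sum_comm]
  refine Finset.sum_congr rfl fun i _ => Finset.sum_congr rfl fun a _ => ?_
  rw [smul_smul, smul_smul, mul_comm]

/-- Pullback along a simplicial map commutes with the simplicial differentials. -/
theorem delta_pullback {n : ℕ} {M' N' : Mfd.{u}} {f : Fin (n + 1) → M → N} {π : N → N'}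
    {π' : M → M'} {f' : Fin (n + 1) → M' → N'} (hf : ∀ i, Smooth (f i)) (hπ : Smooth π)
    (hf' : ∀ i, Smooth (f' i)) (hπ' : Smooth π') (h : ∀ i, π ∘ f i = f' i ∘ π')
    (η : DForm N' k) : delta f (pullback π η) = pullback π' (delta f' η) := by
  simp only [delta, pullback_sum, pullback_smul, pullback_pullback' hπ (hf _),
    pullback_pullback' (hf' _) hπ', h]

/-! ### Gluing forms by partitions of unity -/

/-- The convex combination of forms `η i` on `M`, with coefficients the members of a partition of
unity on `B`, pulled back along `q : M → B`. -/
noncomputable def glue {ι : Type*} (ρ : SmoothPartitionOfUnity ι (𝓡 B.dim) B) (q : M → B)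
    (η : ι → DForm M k) : DForm M k :=
  fun x => ∑ i ∈ ρ.finsupport (q x), ρ i (q x) • η i x

variable {ι : Type*} {ρ : SmoothPartitionOfUnity ι (𝓡 B.dim) B} {U : ι → Set B}

theorem mem_of_mem_finsupport (hρ : ρ.IsSubordinate U) {b : B} {i : ι}
    (hi : i ∈ ρ.finsupport b) : b ∈ U i :=
  hρ i (subset_tsupport _ (by simpa using (ρ.mem_finsupport b).1 hi))

/-- The form `η i` only has to be smooth over the open set `U i`. -/
theorem isSmooth_glue (hρ : ρ.IsSubordinate U) {q : M → B} (hq : Smooth q) {η : ι → DForm M k}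
    (hη : ∀ i x, q x ∈ U i → (η i).SmoothAt x) : (glue ρ q η).IsSmooth := by
  rw [isSmooth_iff]
  intro x
  have h : SmoothAt (∑ i ∈ ρ.fintsupport (q x), fun y => ρ i (q y) • η i y : DForm M k) x := by
    refine SmoothAt.sum fun i hi => ?_
    refine (hη i x (hρ i ((ρ.mem_fintsupport_iff _ i).1 hi))).fun_smul ?_
    exact ((ρ i).contMDiff (q x)).comp x (hq x)
  refine h.congr ?_
  filter_upwards [(hq x).continuousAt.eventually (ρ.eventually_finsupport_subset (q x))] with y hy
  rw [Finset.sum_apply]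
  refine Finset.sum_subset hy fun i _ hi => ?_
  have : ρ i (q y) = 0 := by
    by_contra hne
    exact hi ((ρ.mem_finsupport _).2 hne)
  rw [this, zero_smul]

theorem glue_eq (hρ : ρ.IsSubordinate U) {q : M → B} {η : ι → DForm M k} {x : M}
    {c : TangentSpace (𝓡 M.dim) x [⋀^Fin k]→L[ℝ] ℝ} (h : ∀ i, q x ∈ U i → η i x = c) :
    glue ρ q η x = c := by
  have h1 : ∀ i ∈ ρ.finsupport (q x), ρ i (q x) • η i x = ρ i (q x) • c := fun i hi => by
    rw [h i (mem_of_mem_finsupport hρ hi)]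
  rw [glue, Finset.sum_congr rfl h1, ← Finset.sum_smul, ρ.sum_finsupport _ (Set.mem_univ _),
    one_smul]

theorem pullback_glue (f : L → M) (q : M → B) (η : ι → DForm M k) :
    pullback f (glue ρ q η) = glue ρ (q ∘ f) (fun i => pullback f (η i)) := by
  funext x
  ext v
  simp [pullback, glue, ContinuousAlternatingMap.sum_apply]

/-- The face maps commute with the projections to `B`, so that the coefficients, which are functions
on `B`, are unchanged by them. -/
theorem delta_glue {n : ℕ} {f : Fin (n + 1) → L → M} {q : M → B} {q' : L → B}
    (h : ∀ i, q ∘ f i = q') (η : ι → DForm M k) :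
    delta f (glue ρ q η) = glue ρ q' (fun i => delta f (η i)) := by
  funext x
  simp only [delta_apply, pullback_glue, h, glue, Finset.smul_sum]
  rw [Finset.sum_comm]
  refine Finset.sum_congr rfl fun i _ => Finset.sum_congr rfl fun j _ => ?_
  rw [smul_smul, smul_smul, mul_comm]

end DForm

theorem Mfd.exists_partitionOfUnity (B : Mfd.{u}) {U : B → Set B} (ho : ∀ b, IsOpen (U b))
    (hU : ∀ b, b ∈ U b) :
    ∃ ρ : SmoothPartitionOfUnity B (𝓡 B.dim) B, ρ.IsSubordinate U := by
  have : LocallyCompactSpace B := ChartedSpace.locallyCompactSpace (EuclideanSpace ℝ (Fin B.dim)) B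
  exact SmoothPartitionOfUnity.exists_isSubordinate _ isClosed_univ U ho
    fun b _ => Set.mem_iUnion.2 ⟨b, hU b⟩

/-! ### Local sections and fibre powers of submersions -/

theorem IsSurjSubmersion.smooth {Z B : Mfd.{u}} {π : Z → B} (h : IsSurjSubmersion π) : Smooth π :=
  fun z => (h.submersion.isSubmersionAt z).contMDiffAt

theorem IsSurjSubmersion.exists_localSection {Z B : Mfd.{u}} {π : Z → B}
    (h : IsSurjSubmersion π) (b : B) :
    ∃ (U : Set B) (s : B → Z), IsOpen U ∧ b ∈ U ∧ SmoothOn s U ∧ ∀ x ∈ U, π (s x) = x := by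
  obtain ⟨z, rfl⟩ := h.surjective b
  have hz := h.submersion.isSubmersionAt z
  let φ := hz.domChart
  let ψ := hz.codChart
  let e := hz.equiv
  -- In adapted charts `π` is a projection `(u, v) ↦ u`, with section `u ↦ (u, v)` for the
  -- second coordinate `v` of `z`.
  let y : B → EuclideanSpace ℝ (Fin Z.dim) := fun x => e.symm (ψ x, (e (φ z)).2)
  have hw : ∀ y ∈ φ.target, ψ (π (φ.symm y)) = (e y).1 := fun y hy =>
    hz.writtenInCharts (by simpa [φ] using hy)
  have hsource : ∀ y ∈ φ.target, π (φ.symm y) ∈ ψ.source := fun y hy =>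
    hz.source_subset_preimage_source (φ.map_target hy)
  have hy : ContMDiffOn (𝓡 B.dim) (𝓡 Z.dim) ∞ y ψ.source := by
    have h1 : ContMDiff 𝓘(ℝ, EuclideanSpace ℝ (Fin B.dim)) 𝓘(ℝ, EuclideanSpace ℝ (Fin Z.dim)) ∞
        (fun u : EuclideanSpace ℝ (Fin B.dim) => e.symm (u, (e (φ z)).2)) :=
      (e.symm.contDiff.comp (contDiff_id.prodMk contDiff_const)).contMDiff
    exact h1.comp_contMDiffOn (contMDiffOn_of_mem_maximalAtlas hz.codChart_mem_maximalAtlas)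
  refine ⟨ψ.source ∩ y ⁻¹' φ.target, fun x => φ.symm (y x), ?_, ?_, ?_, ?_⟩
  · exact hy.continuousOn.isOpen_inter_preimage ψ.open_source φ.open_target
  · refine ⟨hz.mem_codChart_source, ?_⟩
    have h1 := hw (φ z) (φ.map_source hz.mem_domChart_source)
    rw [φ.left_inv hz.mem_domChart_source] at h1
    have h2 : y (π z) = φ z := by
      simp only [y, h1, Prod.mk.eta, ContinuousLinearEquiv.symm_apply_apply]
    change y (π z) ∈ φ.target
    rw [h2]
    exact φ.map_source hz.mem_domChart_source
  · exact (contMDiffOn_symm_of_mem_maximalAtlas hz.domChart_mem_maximalAtlas).comp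
      (hy.mono Set.inter_subset_left) fun x hx => hx.2
  · rintro x ⟨hx1, hx2⟩
    refine ψ.injOn (hsource _ hx2) hx1 ?_
    rw [hw _ hx2]
    simp [y]

/-- An open subset of a manifold, as a manifold. -/
noncomputable def Mfd.restrict (M : Mfd.{u}) (V : TopologicalSpace.Opens M) : Mfd.{u} where
  carrier := V
  dim := M.dim

namespace FibrePowers

variable {Y B : Mfd.{u}} {π : Y → B} (C : FibrePowers π)

/-- The projections of a fibre power are jointly injective on points: two points with the same
projections give two constant maps with the same components. -/
theorem ext {n : ℕ} {w w' : C.obj n} (h : ∀ i, C.pr n i w = C.pr n i w') : w = w' := by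
  have := (C.universal n (C.obj n) (fun i _ => C.pr n i w) (fun i => contMDiff_const)
    (fun i j _ => C.pr_eq n i j w)).unique (y₁ := fun _ => w) (y₂ := fun _ => w')
    ⟨contMDiff_const, fun i _ => rfl⟩ ⟨contMDiff_const, fun i _ => (h i).symm⟩
  exact congrFun this w

/-- The universal property of fibre powers for maps defined on an open subset. -/
theorem exists_liftOn {n : ℕ} {T : Mfd.{u}} {V : Set T} (hV : IsOpen V)
    (t : Fin (n + 1) → T → Y) (ht : ∀ i, SmoothOn (t i) V)
    (h : ∀ i j, ∀ x ∈ V, π (t i x) = π (t j x)) :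
    ∃ f : T → C.obj n, SmoothOn f V ∧ ∀ x ∈ V, ∀ i, C.pr n i (f x) = t i x := by
  classical
  let V' : TopologicalSpace.Opens T := ⟨V, hV⟩
  have ht'' : ∀ i, ContMDiff (𝓡 T.dim) (𝓡 Y.dim) ∞ (fun x : V' => t i x) := fun i x =>
    contMDiffAt_subtype_iff.2 ((ht i x x.2).contMDiffAt (hV.mem_nhds x.2))
  have ht' : ∀ i, Smooth (M := T.restrict V') (N := Y) (fun x : V' => t i x) := ht''
  let f' : V' → C.obj n := C.lift (T := T.restrict V') (fun i (x : V') => t i x) ht'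
    fun i j (x : V') => h i j x x.2
  have hf' : Smooth (M := T.restrict V') f' := C.lift_smooth _ _ _
  -- Off `V` any value will do; the diagonal shows that there is one.
  let f : T → C.obj n := fun x =>
    if hx : x ∈ V then f' ⟨x, hx⟩
    else C.lift (fun _ y => y) (fun _ => contMDiff_id) (fun _ _ _ => rfl) (t 0 x)
  have hf : (fun x : V' => f x) = f' := by
    funext x
    simp only [f]
    exact dif_pos x.2
  refine ⟨f, fun x hx => ?_, fun x hx i => ?_⟩
  · have h1 : ContMDiffAt (𝓡 T.dim) (𝓡 (C.obj n).dim) ∞ (fun x : V' => f x) ⟨x, hx⟩ := by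
      rw [hf]
      exact hf' ⟨x, hx⟩
    exact (contMDiffAt_subtype_iff (U := V') (x := ⟨x, hx⟩).1 h1).contMDiffWithinAt
  · have h1 : f x = f' ⟨x, hx⟩ := congrFun hf ⟨x, hx⟩
    rw [h1]
    exact C.pr_lift (T := T.restrict V') _ ht' _ i ⟨x, hx⟩

/-- Over an open set with a local section `s` of `π`, the value of `s` may be inserted as a new
first entry. -/
theorem exists_consOn {n : ℕ} {T : Mfd.{u}} {U : Set B} {s : B → Y} (hU : IsOpen U)
    (hs : SmoothOn s U) (hπs : ∀ x ∈ U, π (s x) = x) {t : Fin (n + 1) → T → Y} {p : T → B}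
    (ht : ∀ i, Smooth (t i)) (hp : Smooth p) (h : ∀ i x, π (t i x) = p x) :
    ∃ f : T → C.obj (n + 1), SmoothOn f (p ⁻¹' U) ∧
      ∀ x ∈ p ⁻¹' U, C.pr (n + 1) 0 (f x) = s (p x) ∧
        ∀ i, C.pr (n + 1) (Fin.succ i) (f x) = t i x := by
  have hc : ∀ i, ∀ x ∈ p ⁻¹' U,
      π ((Fin.cons (s ∘ p) t : Fin (n + 2) → T → Y) i x) = p x := by
    intro i x hx
    refine Fin.cases ?_ (fun i => ?_) i
    · exact hπs _ hx
    · exact h i x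
  obtain ⟨f, hf, hfp⟩ := C.exists_liftOn (hU.preimage hp.continuous)
    (Fin.cons (s ∘ p) t : Fin (n + 2) → T → Y)
    (Fin.cases (hs.comp (hp.contMDiffOn (s := p ⁻¹' U)) fun x hx => hx)
      fun i => (ht i).contMDiffOn) (fun i j x hx => by rw [hc i x hx, hc j x hx])
  exact ⟨f, hf, fun x hx => ⟨hfp x hx 0, fun i => hfp x hx i.succ⟩⟩

theorem map_smooth {m n : ℕ} (f : Fin (m + 1) →o Fin (n + 1)) : Smooth (C.map f) :=
  C.lift_smooth _ _ _

theorem pr_map {m n : ℕ} (f : Fin (m + 1) →o Fin (n + 1)) (i : Fin (m + 1)) (w : C.obj n) :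
    C.pr m i (C.map f w) = C.pr n (f i) w :=
  C.pr_lift _ _ _ i w

theorem face_smooth {n : ℕ} (i : Fin (n + 2)) : Smooth (C.face (n := n) i) := C.map_smooth _

theorem face₀_smooth (i : Fin 2) : Smooth (C.face₀ i) := C.pr_smooth _ _

@[simp] theorem pr_face {n : ℕ} (i : Fin (n + 2)) (j : Fin (n + 1)) (w : C.obj (n + 1)) :
    C.pr n j (C.face i w) = C.pr (n + 1) (i.succAbove j) w :=
  C.pr_map _ _ _

theorem succAbove_succAbove_of_le {n : ℕ} {i j : Fin (n + 2)} (h : i ≤ j) (l : Fin (n + 1)) :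
    j.succ.succAbove (i.succAbove l) = i.castSucc.succAbove (j.succAbove l) := by
  rw [Fin.le_def] at h
  simp only [Fin.succAbove, Fin.lt_def, Fin.ext_iff]
  split_ifs <;> simp_all <;> omega

theorem face_comp_face {n : ℕ} {i j : Fin (n + 2)} (h : i ≤ j) :
    C.face (n := n) i ∘ C.face j.succ = C.face j ∘ C.face i.castSucc := by
  funext w
  apply C.ext
  intro l
  simp only [Function.comp, pr_face, succAbove_succAbove_of_le h]

end FibrePowers

/-! ### Exactness of the simplicial differential for submersions -/

namespace DForm

variable {k : ℕ}

/-- Exactness of an augmented simplicial complex of forms, for face maps over `B` that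
have an extra degeneracy over each member of an open cover of `B`. On the part of `M` over `U b` the
pullback of `δω = 0` along the extra degeneracy `T b` reads `ω = δ((S b)^* ω)`, and a partition of
unity on `B` glues the forms `(S b)^* ω`. -/
theorem exists_delta_eq_of_extraDegeneracy {B A M N : Mfd.{u}} {n : ℕ} {q : A → B} {q' : M → B}
    {f : Fin (n + 1) → M → A} {g : Fin (n + 2) → N → M} {U : B → Set B} {S : B → A → M}
    {T : B → M → N} (hq : Smooth q) (hf : ∀ i, Smooth (f i)) (hg : ∀ i, Smooth (g i))
    (hqf : ∀ i, q ∘ f i = q') (hU : ∀ b, IsOpen (U b)) (hb : ∀ b, b ∈ U b)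
    (hS : ∀ b, SmoothOn (S b) (q ⁻¹' U b)) (hT : ∀ b, SmoothOn (T b) (q' ⁻¹' U b))
    (hT0 : ∀ b x, q' x ∈ U b → g 0 (T b x) = x)
    (hTs : ∀ b x, q' x ∈ U b → ∀ i, g i.succ (T b x) = S b (f i x))
    {η : DForm M k} (hη : η.IsSmooth) (h0 : delta g η = 0) :
    ∃ ζ : DForm A k, ζ.IsSmooth ∧ delta f ζ = η := by
  obtain ⟨ρ, hρ⟩ := B.exists_partitionOfUnity hU hb
  have hq' : Smooth q' := hqf 0 ▸ hq.comp (hf 0)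
  have hSA : ∀ b x, q x ∈ U b → ContMDiffAt (𝓡 A.dim) (𝓡 M.dim) ∞ (S b) x := fun b x hx =>
    (hS b x hx).contMDiffAt (((hU b).preimage hq.continuous).mem_nhds hx)
  refine ⟨glue ρ q (fun b => pullback (S b) η), isSmooth_glue hρ hq fun b x hx =>
    (isSmooth_iff.1 hη _).pullback (hSA b x hx), ?_⟩
  rw [delta_glue hqf]
  funext x
  refine glue_eq hρ fun b hx => ?_
  have hnhds : q' ⁻¹' U b ∈ 𝓝 x := ((hU b).preimage hq'.continuous).mem_nhds hx
  have hTx : MDifferentiableAt (𝓡 M.dim) (𝓡 N.dim) (T b) x :=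
    ((hT b x hx).contMDiffAt hnhds).mdifferentiableAt (by simp)
  have h1 : pullback (T b) (delta g η) x = 0 := by rw [h0]; rfl
  simp only [delta, pullback_sum, pullback_smul, Finset.sum_apply, Pi.smul_apply] at h1
  rw [Fin.sum_univ_succ] at h1
  have e0 : pullback (T b) (pullback (g 0) η) x = η x := by
    rw [pullback_pullback ((hg 0 _).mdifferentiableAt (by simp)) hTx]
    refine (pullback_congr (g := id) ?_ η).trans (congrFun (pullback_id η) x)
    filter_upwards [hnhds] with y hy using hT0 b y hy
  have es : ∀ i, pullback (T b) (pullback (g (Fin.succ i)) η) x =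
      pullback (f i) (pullback (S b) η) x := fun i => by
    have hfx : q (f i x) ∈ U b := by rw [← hqf i] at hx; exact hx
    rw [pullback_pullback ((hg _ _).mdifferentiableAt (by simp)) hTx,
      pullback_pullback ((hSA b _ hfx).mdifferentiableAt (by simp))
        ((hf i x).mdifferentiableAt (by simp))]
    refine pullback_congr ?_ η
    filter_upwards [hnhds] with y hy using hTs b y hy i
  have hneg : ∀ (c : ℝ) (a : TangentSpace (𝓡 M.dim) x [⋀^Fin k]→L[ℝ] ℝ),
      (c * -1) • a = -(c • a) := fun c a => by
    ext v
    change c * -1 * a v = -(c * a v)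
    ring
  simp only [e0, es, Fin.val_zero, pow_zero, one_smul, Fin.val_succ, pow_succ, hneg,
    Finset.sum_neg_distrib] at h1
  rw [delta_apply]
  exact (add_neg_eq_zero.1 h1).symm

variable {Y B : Mfd.{u}} {π : Y → B}

/-- A form on `Y` whose two pullbacks to `Y^{[2]}` agree descends to `B`. -/
theorem exists_pullback_eq (hπ : IsSurjSubmersion π) (C : FibrePowers π) {η : DForm Y k}
    (hη : η.IsSmooth) (h0 : delta C.face₀ η = 0) :
    ∃ ζ : DForm B k, ζ.IsSmooth ∧ pullback π ζ = η := by
  choose U s hU hb hs hπs using hπ.exists_localSection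
  choose T hT hTp using fun b => C.exists_consOn (hU b) (hs b) (hπs b) (n := 0)
    (t := fun _ => id) (p := π) (fun _ => contMDiff_id) hπ.smooth (fun _ _ => rfl)
  obtain ⟨ζ, hζ, h⟩ := exists_delta_eq_of_extraDegeneracy (n := 0) (q := id) (q' := π)
    (f := fun _ => π) (g := C.face₀) contMDiff_id (fun _ => hπ.smooth) C.face₀_smooth
    (fun _ => rfl) hU hb hs hT (fun b x hx => (hTp b x hx).2 0)
    (fun b x hx => Fin.forall_fin_one.2 (hTp b x hx).1) hη h0
  exact ⟨ζ, hζ, by simpa [delta] using h⟩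

/-- Exactness of the complex of forms on the fibre powers at `Y^{[2]}`. -/
theorem exists_delta_face₀_eq (hπ : IsSurjSubmersion π) (C : FibrePowers π)
    {η : DForm (C.obj 1) k} (hη : η.IsSmooth) (h0 : delta C.face η = 0) :
    ∃ ζ : DForm Y k, ζ.IsSmooth ∧ delta C.face₀ ζ = η := by
  choose U s hU hb hs hπs using hπ.exists_localSection
  have hq := hπ.smooth.comp (C.pr_smooth 1 0)
  choose S hS hSp using fun b => C.exists_consOn (hU b) (hs b) (hπs b) (n := 0)
    (t := fun _ => id) (p := π) (fun _ => contMDiff_id) hπ.smooth (fun _ _ => rfl)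
  choose T hT hTp using fun b => C.exists_consOn (hU b) (hs b) (hπs b) (n := 1)
    (t := C.pr 1) (p := π ∘ C.pr 1 0) (C.pr_smooth 1) hq (fun i x => C.pr_eq 1 i 0 x)
  have hface : ∀ i, π ∘ C.face₀ i = π ∘ C.pr 1 0 := fun i => funext fun x => C.pr_eq 1 _ _ x
  refine exists_delta_eq_of_extraDegeneracy (q := π) (q' := π ∘ C.pr 1 0) hπ.smooth
    C.face₀_smooth C.face_smooth hface hU hb hS hT (fun b x hx => C.ext fun l => ?_)
    (fun b x hx i => C.ext fun l => ?_) hη h0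
  · rw [C.pr_face, Fin.zero_succAbove, (hTp b x hx).2]
  · have hfx : π (C.face₀ i x) = π (C.pr 1 0 x) := congrFun (hface i) x
    have hx' : π (C.face₀ i x) ∈ U b := by rw [hfx]; exact hx
    rw [C.pr_face]
    refine Fin.cases ?_ (fun l => ?_) l
    · rw [Fin.succ_succAbove_zero, (hTp b x hx).1, (hSp b _ hx').1, hfx]
      rfl
    · rw [Fin.succ_succAbove_succ, (hTp b x hx).2, (hSp b _ hx').2, Subsingleton.elim l 0]
      rfl

/-- Exactness of the complex of forms on the fibre powers at `Y^{[n+2]}`. -/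
theorem exists_delta_face_eq (hπ : IsSurjSubmersion π) (C : FibrePowers π) {n : ℕ}
    {η : DForm (C.obj (n + 1)) k} (hη : η.IsSmooth)
    (h0 : delta (C.face (n := n + 1)) η = 0) :
    ∃ ζ : DForm (C.obj n) k, ζ.IsSmooth ∧ delta (C.face (n := n)) ζ = η := by
  choose U s hU hb hs hπs using hπ.exists_localSection
  have hq : ∀ m, Smooth (π ∘ C.pr m 0) := fun m => hπ.smooth.comp (C.pr_smooth m 0)
  have hc : ∀ b m, ∃ S : C.obj m → C.obj (m + 1), SmoothOn S ((π ∘ C.pr m 0) ⁻¹' U b) ∧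
      ∀ x ∈ (π ∘ C.pr m 0) ⁻¹' U b, C.pr (m + 1) 0 (S x) = s b (π (C.pr m 0 x)) ∧
        ∀ i, C.pr (m + 1) (Fin.succ i) (S x) = C.pr m i x := fun b m =>
    C.exists_consOn (hU b) (hs b) (hπs b) (C.pr_smooth m) (hq m) (fun i x => C.pr_eq m i 0 x)
  choose S hS hSp using hc
  have hface : ∀ i, (π ∘ C.pr n 0) ∘ C.face i = π ∘ C.pr (n + 1) 0 := fun i => funext fun x => by
    simp only [Function.comp, C.pr_face]
    exact C.pr_eq _ _ _ x
  refine exists_delta_eq_of_extraDegeneracy (S := fun b => S b n) (T := fun b => S b (n + 1))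
    (hq n) C.face_smooth C.face_smooth hface hU hb (fun b => hS b n) (fun b => hS b (n + 1))
    (fun b x hx => C.ext fun l => ?_) (fun b x hx i => C.ext fun l => ?_) hη h0
  · rw [C.pr_face, Fin.zero_succAbove, (hSp b _ x hx).2]
  · have hfx : π (C.pr n 0 (C.face i x)) = π (C.pr (n + 1) 0 x) := congrFun (hface i) x
    have hx' : π (C.pr n 0 (C.face i x)) ∈ U b := by rw [hfx]; exact hx
    rw [C.pr_face]
    refine Fin.cases ?_ (fun l => ?_) l
    · rw [Fin.succ_succAbove_zero, (hSp b _ x hx).1, (hSp b _ _ hx').1, hfx]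
    · rw [Fin.succ_succAbove_succ, (hSp b _ x hx).2, (hSp b _ _ hx').2, C.pr_face]

end DForm

/-! ### Circle-valued functions and their logarithmic derivatives -/

instance : LieGroup (𝓡 1) ∞ Circle := LieGroup.of_le (n := ω) (by simp)

theorem contMDiff_circle_coe : ContMDiff (𝓡 1) 𝓘(ℝ, ℂ) ∞ (fun z : Circle => (z : ℂ)) := by
  have : Fact (Module.finrank ℝ ℂ = 1 + 1) := finrank_real_complex_fact'
  exact contMDiff_coe_sphere

namespace DForm

variable {M N : Mfd.{u}}

/-- The differential of a real function, as a 1-form. -/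
noncomputable def dfun (θ : M → ℝ) : DForm M 1 := fun x =>
  ContinuousAlternatingMap.ofSubsingleton ℝ (TangentSpace (𝓡 M.dim) x) ℝ (0 : Fin 1)
    (mfderiv (𝓡 M.dim) 𝓘(ℝ, ℝ) θ x)

/-- The differential of a function is its exterior derivative as a 0-form. -/
theorem dfun_inChart {θ : M → ℝ} {x : M} (hθ : ContMDiffAt (𝓡 M.dim) 𝓘(ℝ, ℝ) ∞ θ x) :
    (dfun θ).inChart x =ᶠ[𝓝 (ch x x)] extDeriv (fun y =>
      ContinuousAlternatingMap.constOfIsEmpty ℝ (EuclideanSpace ℝ (Fin M.dim)) (Fin 0)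
        ((θ ∘ (ch x).symm) y)) := by
  have hc : ContinuousAt (ch x).symm (ch x x) :=
    (ch x).continuousAt_symm (mem_chart_target _ x)
  have e1 : ∀ᶠ y in 𝓝 (ch x x), MDifferentiableAt (𝓡 M.dim) 𝓘(ℝ, ℝ) θ ((ch x).symm y) :=
    hc.eventually (by
      rw [(ch x).left_inv (mem_chart_source _ x)]; exact hθ.eventually_mdifferentiableAt)
  filter_upwards [e1, (ch x).open_target.mem_nhds (mem_chart_target _ x)] with y hy hy'
  have c := mfderiv_comp y hy (mdifferentiableAt_ch_symm hy')
  rw [extDeriv_constOfIsEmpty, ← mfderiv_eq_fderiv, c]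
  ext v
  rfl

theorem contDiffAt_constOfIsEmpty_comp_ch_symm {θ : M → ℝ} {x : M}
    (hθ : ContMDiffAt (𝓡 M.dim) 𝓘(ℝ, ℝ) ∞ θ x) :
    ContDiffAt ℝ ∞ (fun y =>
      ContinuousAlternatingMap.constOfIsEmpty ℝ (EuclideanSpace ℝ (Fin M.dim)) (Fin 0)
        ((θ ∘ (ch x).symm) y)) (ch x x) := by
  have h1 : ContDiffAt ℝ ∞ (θ ∘ (ch x).symm) (ch x x) := by
    rw [← contMDiffAt_iff_contDiffAt]
    refine ContMDiffAt.comp (I' := 𝓡 M.dim) (ch x x) ?_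
      (contMDiffAt_ch_symm (mem_chart_target _ x))
    rwa [(ch x).left_inv (mem_chart_source _ x)]
  exact contDiffAt_alternating_of_apply fun v => h1

theorem smoothAt_dfun {θ : M → ℝ} {x : M} (hθ : ContMDiffAt (𝓡 M.dim) 𝓘(ℝ, ℝ) ∞ θ x) :
    (dfun θ).SmoothAt x :=
  (contDiffAt_constOfIsEmpty_comp_ch_symm hθ).extDeriv.congr_of_eventuallyEq (dfun_inChart hθ)

theorem d_dfun {θ : M → ℝ} {x : M} (hθ : ContMDiffAt (𝓡 M.dim) 𝓘(ℝ, ℝ) ∞ θ x) :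
    (dfun θ).d x = 0 := by
  have : extDeriv ((dfun θ).inChart x) (ch x x) = 0 := by
    rw [(dfun_inChart hθ).extDeriv_eq]
    exact extDeriv_extDeriv_apply (contDiffAt_constOfIsEmpty_comp_ch_symm hθ)
      minSmoothness_two_le_infty
  change (extDeriv ((dfun θ).inChart x) (ch x x)).compContinuousLinearMap _ = 0
  rw [this]
  rfl

theorem dfun_add {θ θ' : M → ℝ} {x : M} (h : MDifferentiableAt (𝓡 M.dim) 𝓘(ℝ, ℝ) θ x)
    (h' : MDifferentiableAt (𝓡 M.dim) 𝓘(ℝ, ℝ) θ' x) :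
    dfun (fun y => θ y + θ' y) x = dfun θ x + dfun θ' x := by
  have e : mfderiv (𝓡 M.dim) 𝓘(ℝ, ℝ) (fun y => θ y + θ' y) x = _ :=
    (h.hasMFDerivAt.add h'.hasMFDerivAt).mfderiv
  rw [dfun, e]
  rfl

theorem dfun_const_mul {θ : M → ℝ} {x : M} (c : ℝ)
    (h : MDifferentiableAt (𝓡 M.dim) 𝓘(ℝ, ℝ) θ x) :
    dfun (fun y => c * θ y) x = c • dfun θ x := by
  have e : mfderiv (𝓡 M.dim) 𝓘(ℝ, ℝ) (fun y => c * θ y) x = _ :=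
    (h.hasMFDerivAt.const_smul c).mfderiv
  rw [dfun, e]
  rfl

theorem pullback_dfun {f : M → N} {θ : N → ℝ} {x : M}
    (hθ : MDifferentiableAt (𝓡 N.dim) 𝓘(ℝ, ℝ) θ (f x))
    (hf : MDifferentiableAt (𝓡 M.dim) (𝓡 N.dim) f x) :
    pullback f (dfun θ) x = dfun (θ ∘ f) x := by
  rw [dfun, mfderiv_comp x hθ hf]
  ext v
  rfl

/-- A smooth circle-valued function is locally the exponential of a smooth angle. -/
theorem exists_angle {g : M → Circle} {x : M} (hg : ContMDiffAt (𝓡 M.dim) (𝓡 1) ∞ g x) :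
    ∃ θ : M → ℝ, ContMDiffAt (𝓡 M.dim) 𝓘(ℝ, ℝ) ∞ θ x ∧
      ∀ y, g y = g x * Circle.exp (θ y) := by
  refine ⟨fun y => Complex.arg ((g y / g x : Circle) : ℂ), ?_, fun y => ?_⟩
  · have h1 : ContMDiffAt (𝓡 M.dim) 𝓘(ℝ, ℂ) ∞ (fun y => ((g y / g x : Circle) : ℂ)) x :=
      (contMDiff_circle_coe _).comp x (hg.div contMDiffAt_const)
    have h0 : ContDiffAt ℝ ∞ Complex.log ((g x / g x : Circle) : ℂ) :=
      (Complex.contDiffAt_log (by simp)).restrict_scalars ℝ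
    have h2 : ContDiffAt ℝ ∞ (fun z : ℂ => (Complex.log z).im) ((g x / g x : Circle) : ℂ) :=
      Complex.imCLM.contDiff.contDiffAt.fun_comp (f := Complex.log) _ h0
    have h3 := h2.contMDiffAt.comp x (g := fun z : ℂ => (Complex.log z).im) h1
    simpa only [Function.comp_def, Complex.log_im] using h3
  · rw [Circle.exp_arg]
    simp

theorem dlog_congr {g g' : M → Circle} {x : M} (h : g =ᶠ[𝓝 x] g') : dlog g x = dlog g' x := by
  have h' : (fun y => (g y : ℂ)) =ᶠ[𝓝 x] fun y => (g' y : ℂ) := by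
    filter_upwards [h] with y hy using by rw [hy]
  simp only [dlog]
  rw [h.self_of_nhds, h'.mfderiv_eq]

theorem dlog_eq_dfun {g : M → Circle} {x : M} {c : Circle} {θ : M → ℝ}
    (hθ : MDifferentiableAt (𝓡 M.dim) 𝓘(ℝ, ℝ) θ x)
    (h : ∀ᶠ y in 𝓝 x, g y = c * Circle.exp (θ y)) : dlog g x = dfun θ x := by
  rw [dlog_congr (g' := fun y => c * Circle.exp (θ y)) h]
  have hd : HasFDerivAt (fun r : ℝ => ((c * Circle.exp r : Circle) : ℂ))
      ((ContinuousLinearMap.toSpanSingleton ℝ ((c * Circle.exp (θ x) : Circle) * Complex.I : ℂ)))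
      (θ x) := by
    have h1 : HasDerivAt (fun r : ℝ => (c : ℂ) * Complex.exp (r * Complex.I))
        ((c : ℂ) * (Complex.exp (θ x * Complex.I) * Complex.I)) (θ x) := by
      have h2 : HasDerivAt (fun r : ℝ => ((r : ℂ) * Complex.I)) (1 * Complex.I) (θ x) :=
        (Complex.ofRealCLM.hasDerivAt (x := θ x)).mul_const _
      rw [one_mul] at h2
      exact h2.cexp.const_mul _
    have h3 := h1.hasFDerivAt
    simpa [Circle.coe_exp, mul_assoc] using h3
  have e := (hd.hasMFDerivAt.comp x hθ.hasMFDerivAt).mfderiv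
  have e' : mfderiv (𝓡 M.dim) 𝓘(ℝ, ℂ) (fun y => ((c * Circle.exp (θ y) : Circle) : ℂ)) x = _ := e
  rw [dlog, e']
  ext v
  simp only [dfun, ContinuousAlternatingMap.ofSubsingleton_apply_apply]
  have key : ∀ (z : Circle) (r : ℝ),
      ((starRingEnd ℂ) (z : ℂ) * (r • ((z : ℂ) * Complex.I))).im = r := fun z r => by
    have hz : (starRingEnd ℂ) (z : ℂ) * z = 1 := by
      rw [← Circle.coe_inv_eq_conj, ← Circle.coe_mul]; simp
    rw [mul_smul_comm, ← mul_assoc, hz]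
    simp
  exact key (c * Circle.exp (θ x)) (mfderiv (𝓡 M.dim) 𝓘(ℝ, ℝ) θ x (v 0))

/-- Near a point, `-i g⁻¹ dg` is the differential of an angle of `g`. -/
theorem dlog_eventuallyEq_dfun {g : M → Circle} {x : M}
    (hg : ContMDiffAt (𝓡 M.dim) (𝓡 1) ∞ g x) :
    ∃ θ : M → ℝ, ContMDiffAt (𝓡 M.dim) 𝓘(ℝ, ℝ) ∞ θ x ∧ (∀ y, g y = g x * Circle.exp (θ y)) ∧
      ∀ᶠ y in 𝓝 x, dlog g y = dfun θ y := by
  obtain ⟨θ, hθ, h⟩ := exists_angle hg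
  refine ⟨θ, hθ, h, ?_⟩
  filter_upwards [hθ.eventually_mdifferentiableAt] with y hy
  exact dlog_eq_dfun hy (Filter.Eventually.of_forall h)

theorem smoothAt_dlog {g : M → Circle} {x : M} (hg : ContMDiffAt (𝓡 M.dim) (𝓡 1) ∞ g x) :
    (dlog g).SmoothAt x := by
  obtain ⟨θ, hθ, -, h⟩ := dlog_eventuallyEq_dfun hg
  exact (smoothAt_dfun hθ).congr h

theorem d_dlog {g : M → Circle} {x : M} (hg : ContMDiffAt (𝓡 M.dim) (𝓡 1) ∞ g x) :
    (dlog g).d x = 0 := by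
  obtain ⟨θ, hθ, -, h⟩ := dlog_eventuallyEq_dfun hg
  rw [d_congr h, d_dfun hθ]

theorem dlog_const (c : Circle) (x : M) : dlog (fun _ : M => c) x = 0 := by
  rw [dlog, mfderiv_const]
  ext v
  change ((starRingEnd ℂ) (c : ℂ) * 0).im = 0
  simp

theorem pullback_dlog {f : M → N} {g : N → Circle} {x : M}
    (hg : ContMDiffAt (𝓡 N.dim) (𝓡 1) ∞ g (f x))
    (hf : MDifferentiableAt (𝓡 M.dim) (𝓡 N.dim) f x) :
    pullback f (dlog g) x = dlog (g ∘ f) x := by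
  obtain ⟨θ, hθ, h', h⟩ := dlog_eventuallyEq_dfun hg
  have hθ' := hθ.mdifferentiableAt (by simp)
  rw [pullback_apply_congr h.self_of_nhds, pullback_dfun hθ' hf]
  exact (dlog_eq_dfun (hθ'.comp x hf) (Filter.Eventually.of_forall fun y => h' (f y))).symm

theorem dlog_mul {g g' : M → Circle} {x : M} (hg : ContMDiffAt (𝓡 M.dim) (𝓡 1) ∞ g x)
    (hg' : ContMDiffAt (𝓡 M.dim) (𝓡 1) ∞ g' x) :
    dlog (fun y => g y * g' y) x = dlog g x + dlog g' x := by
  obtain ⟨θ, hθ, h, e⟩ := dlog_eventuallyEq_dfun hg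
  obtain ⟨θ', hθ', h', e'⟩ := dlog_eventuallyEq_dfun hg'
  have d1 := hθ.mdifferentiableAt (n := ∞) (by simp)
  have d2 := hθ'.mdifferentiableAt (n := ∞) (by simp)
  rw [e.self_of_nhds, e'.self_of_nhds, ← dfun_add d1 d2]
  refine dlog_eq_dfun (c := g x * g' x) (d1.add d2) (Filter.Eventually.of_forall fun y => ?_)
  rw [h y, h' y, Circle.exp_add, mul_mul_mul_comm]

theorem dlog_zpow {g : M → Circle} {x : M} (hg : ContMDiffAt (𝓡 M.dim) (𝓡 1) ∞ g x) (n : ℤ) :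
    dlog (fun y => g y ^ n) x = (n : ℝ) • dlog g x := by
  obtain ⟨θ, hθ, h, e⟩ := dlog_eventuallyEq_dfun hg
  have d1 := hθ.mdifferentiableAt (n := ∞) (by simp)
  rw [e.self_of_nhds, ← dfun_const_mul _ d1]
  refine dlog_eq_dfun (c := g x ^ n) (d1.const_smul (n : ℝ))
    (Filter.Eventually.of_forall fun y => ?_)
  rw [h y, mul_zpow, ← Circle.exp_intCast_mul]

theorem contMDiffAt_circle_zpow {g : M → Circle} {x : M}
    (hg : ContMDiffAt (𝓡 M.dim) (𝓡 1) ∞ g x) (n : ℤ) :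
    ContMDiffAt (𝓡 M.dim) (𝓡 1) ∞ (fun y => g y ^ n) x := by
  cases n with
  | ofNat n => simpa using hg.pow n
  | negSucc n => simpa using (hg.pow (n + 1)).inv

theorem contMDiffAt_circle_prod {ι : Type*} {s : Finset ι} {g : ι → M → Circle} {x : M}
    (hg : ∀ i ∈ s, ContMDiffAt (𝓡 M.dim) (𝓡 1) ∞ (g i) x) :
    ContMDiffAt (𝓡 M.dim) (𝓡 1) ∞ (fun y => ∏ i ∈ s, g i y) x :=
  contMDiffAt_finsetProd hg

theorem dlog_prod {ι : Type*} {s : Finset ι} {g : ι → M → Circle} {x : M}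
    (hg : ∀ i ∈ s, ContMDiffAt (𝓡 M.dim) (𝓡 1) ∞ (g i) x) :
    dlog (fun y => ∏ i ∈ s, g i y) x = ∑ i ∈ s, dlog (g i) x := by
  classical
  induction s using Finset.induction_on with
  | empty => simpa using dlog_const 1 x
  | insert i s hi ih =>
    have hs : ∀ j ∈ s, ContMDiffAt (𝓡 M.dim) (𝓡 1) ∞ (g j) x := fun j hj => hg j (by simp [hj])
    simp only [Finset.prod_insert hi, Finset.sum_insert hi]
    rw [dlog_mul (hg i (by simp)) (contMDiffAt_circle_prod hs), ih hs]

end DForm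

/-! ### Connections on circle bundles -/

namespace U1Bundle

variable {B T : Mfd.{u}} (E : U1Bundle B)

theorem smooth_smul (z : Circle) : Smooth (fun p : E.P => z • p) :=
  E.act_smooth.comp (contMDiff_const.prodMk contMDiff_id)

theorem smul_right_cancel {z z' : Circle} {p : E.P} (h : z • p = z' • p) : z = z' := by
  have h1 := E.free (z'⁻¹ * z) p (by rw [mul_smul, h, inv_smul_smul])
  exact (inv_mul_eq_one.1 h1).symm

theorem exists_localSection (b : B) :
    ∃ (U : Set B) (s : B → E.P), IsOpen U ∧ b ∈ U ∧ SmoothOn s U ∧ ∀ x ∈ U, E.proj (s x) = x := by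
  obtain ⟨U, s, τ, hU, hb, hs, hp, -⟩ := E.locally_trivial b
  exact ⟨U, s, hU, hb, hs, hp⟩

/-- Two local sections of a circle bundle along the same map differ by a smooth circle-valued
function. -/
theorem exists_smul_eq {U : Set T} (hU : IsOpen U) {s s' : T → E.P} (hs : SmoothOn s U)
    (hs' : SmoothOn s' U) (h : ∀ y ∈ U, E.proj (s' y) = E.proj (s y)) :
    ∃ z : T → Circle, (∀ y ∈ U, ContMDiffAt (𝓡 T.dim) (𝓡 1) ∞ z y) ∧
      ∀ y ∈ U, s' y = z y • s y := by
  have hex : ∀ y, ∃ z : Circle, y ∈ U → s' y = z • s y := by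
    intro y
    by_cases hy : y ∈ U
    · obtain ⟨V, σ, τ, -, hb, -, -, -, hτ⟩ := E.locally_trivial (E.proj (s y))
      refine ⟨τ (s' y) * (τ (s y))⁻¹, fun _ => ?_⟩
      have h1 := hτ (s' y) (by rwa [h y hy])
      have h2 : σ (E.proj (s y)) = (τ (s y))⁻¹ • s y := by
        rw [eq_inv_smul_iff, hτ (s y) hb]
      rw [h y hy, h2, smul_smul] at h1
      exact h1.symm
    · exact ⟨1, fun hy' => absurd hy' hy⟩
  choose z hz using hex
  refine ⟨z, fun y₀ hy₀ => ?_, hz⟩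
  obtain ⟨V, σ, τ, hV, hb, -, -, hτs, hτ⟩ := E.locally_trivial (E.proj (s y₀))
  have hsy := (hs y₀ hy₀).contMDiffAt (hU.mem_nhds hy₀)
  have hsy' := (hs' y₀ hy₀).contMDiffAt (hU.mem_nhds hy₀)
  have hV' : IsOpen (E.proj ⁻¹' V) := hV.preimage E.proj_smooth.continuous
  have hb' : E.proj (s' y₀) ∈ V := by rwa [h y₀ hy₀]
  have h1 : ContMDiffAt (𝓡 T.dim) (𝓡 1) ∞ (fun y => τ (s' y) / τ (s y)) y₀ :=
    (((hτs _ hb').contMDiffAt (hV'.mem_nhds hb')).comp y₀ hsy').div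
      (((hτs _ hb).contMDiffAt (hV'.mem_nhds hb)).comp y₀ hsy)
  refine h1.congr_of_eventuallyEq ?_
  filter_upwards [hU.mem_nhds hy₀, hsy.continuousAt.eventually (hV'.mem_nhds hb)] with y hy hyV
  refine E.smul_right_cancel (p := s y) ?_
  rw [← hz y hy]
  have hyV' : E.proj (s' y) ∈ V := by rw [h y hy]; exact hyV
  have h1 := hτ (s' y) hyV'
  have h2 : σ (E.proj (s y)) = (τ (s y))⁻¹ • s y := by
    rw [eq_inv_smul_iff, hτ (s y) hyV]
  rw [h y hy, h2, smul_smul, ← div_eq_mul_inv] at h1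
  exact h1.symm

end U1Bundle

namespace DForm

/-- A 1-form at a point as a linear functional. -/
noncomputable def lin {E : Type*} [AddCommGroup E] [Module ℝ E] [TopologicalSpace E]
    (a : E [⋀^Fin 1]→L[ℝ] ℝ) : E →L[ℝ] ℝ :=
  (ContinuousAlternatingMap.ofSubsingleton ℝ E ℝ (0 : Fin 1)).symm a

end DForm

namespace IsConnection

variable {B T : Mfd.{u}} {E : U1Bundle B} {A : DForm E.P 1}

/-- The pullback of a connection along `z • s` is `s^* A + z⁻¹ dz`. -/
theorem pullback_smul (hA : IsConnection E A) {z : T → Circle} {s : T → E.P} {t : T}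
    (hz : ContMDiffAt (𝓡 T.dim) (𝓡 1) ∞ z t) (hs : ContMDiffAt (𝓡 T.dim) (𝓡 E.P.dim) ∞ s t) :
    DForm.pullback (fun y => z y • s y) A t = DForm.dlog z t + DForm.pullback s A t := by
  obtain ⟨θ, hθ, hzθ, hdlog⟩ := DForm.dlog_eventuallyEq_dfun hz
  rw [hdlog.self_of_nhds]
  have hθ' := hθ.mdifferentiableAt (n := ∞) (by simp)
  have hs' := hs.mdifferentiableAt (n := ∞) (by simp)
  -- By invariance the constant `z t` may be dropped from `z • s = z t • exp (i θ) • s`; the rest is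
  -- the product rule for the action `a` of angles on `E`.
  let a : ℝ × E.P → E.P := fun q => Circle.exp q.1 • q.2
  have ha : ContMDiff (𝓘(ℝ, ℝ).prod (𝓡 E.P.dim)) (𝓡 E.P.dim) ∞ a :=
    E.act_smooth.comp ((contMDiff_circleExp.comp contMDiff_fst).prodMk contMDiff_snd)
  let w : T → E.P := fun y => Circle.exp (θ y) • s y
  have hpair : MDifferentiableAt (𝓡 T.dim) (𝓘(ℝ, ℝ).prod (𝓡 E.P.dim)) (fun y => (θ y, s y)) t :=
    hθ'.prodMk hs'
  have haq : MDifferentiableAt (𝓘(ℝ, ℝ).prod (𝓡 E.P.dim)) (𝓡 E.P.dim) a (θ t, s t) :=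
    (ha _).mdifferentiableAt (by simp)
  have hw : MDifferentiableAt (𝓡 T.dim) (𝓡 E.P.dim) w t := haq.comp t hpair
  have e1 : DForm.pullback (fun y => z y • s y) A t = DForm.pullback w A t := by
    have : (fun y => z y • s y) = (fun p : E.P => z t • p) ∘ w := by
      funext y
      simp only [w, Function.comp, hzθ y, mul_smul]
    rw [this, ← DForm.pullback_pullback ((E.smooth_smul (z t) _).mdifferentiableAt (by simp)) hw,
      hA.invariant]
  rw [e1]
  have e2 : mfderiv (𝓡 T.dim) (𝓡 E.P.dim) w t = _ := mfderiv_comp t haq hpair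
  ext v
  have hv : v = fun _ => v 0 := funext fun i => by rw [Subsingleton.elim i 0]
  rw [hv]
  have e3 : mfderiv (𝓡 T.dim) (𝓡 E.P.dim) w t (v 0) =
      mfderiv 𝓘(ℝ, ℝ) (𝓡 E.P.dim) (fun r => Circle.exp r • s t) (θ t)
        (mfderiv (𝓡 T.dim) 𝓘(ℝ, ℝ) θ t (v 0)) +
      mfderiv (𝓡 E.P.dim) (𝓡 E.P.dim) (fun p => Circle.exp (θ t) • p) (s t)
        (mfderiv (𝓡 T.dim) (𝓡 E.P.dim) s t (v 0)) := by
    rw [e2, hθ'.mfderiv_prod hs']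
    exact mfderiv_prod_eq_add_apply haq
  have hinv : DForm.lin (A (Circle.exp (θ t) • s t))
      (mfderiv (𝓡 E.P.dim) (𝓡 E.P.dim) (fun p => Circle.exp (θ t) • p) (s t)
        (mfderiv (𝓡 T.dim) (𝓡 E.P.dim) s t (v 0))) =
      A (s t) (fun _ => mfderiv (𝓡 T.dim) (𝓡 E.P.dim) s t (v 0)) :=
    congrArg (fun η : DForm E.P 1 => η (s t)
      (fun _ => mfderiv (𝓡 T.dim) (𝓡 E.P.dim) s t (v 0))) (hA.invariant (Circle.exp (θ t)))
  have hvert : ∀ c : ℝ, DForm.lin (A (Circle.exp (θ t) • s t))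
      (mfderiv 𝓘(ℝ, ℝ) (𝓡 E.P.dim) (fun r => Circle.exp r • s t) (θ t) c) = c := fun c => by
    let D : ℝ →L[ℝ] ℝ := (DForm.lin (A (Circle.exp (θ t) • s t))).comp
      (mfderiv 𝓘(ℝ, ℝ) (𝓡 E.P.dim) (fun r => Circle.exp r • s t) (θ t))
    have h1 : D 1 = 1 := hA.vertical (s t) (θ t)
    have h2 : D c = c • D 1 := by rw [← map_smul, smul_eq_mul, mul_one]
    rw [h1, smul_eq_mul, mul_one] at h2
    exact h2
  have e4 : DForm.pullback w A t (fun _ => v 0) =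
      DForm.lin (A (Circle.exp (θ t) • s t)) (mfderiv (𝓡 T.dim) (𝓡 E.P.dim) w t (v 0)) := rfl
  rw [e4, e3, map_add, hinv]
  exact congrArg₂ (· + ·) (hvert _) rfl

end IsConnection

/-- Connections exist, since a convex combination of connections is a connection. -/
theorem U1Bundle.exists_isConnection {B : Mfd.{u}} (E : U1Bundle B) :
    ∃ A : DForm E.P 1, IsConnection E A := by
  choose U s τ hU hb hs hps hτs hτ using E.locally_trivial
  obtain ⟨ρ, hρ⟩ := B.exists_partitionOfUnity hU hb
  have hτA : ∀ b p, E.proj p ∈ U b → ContMDiffAt (𝓡 E.P.dim) (𝓡 1) ∞ (τ b) p := fun b p hp =>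
    (hτs b p hp).contMDiffAt (((hU b).preimage E.proj_smooth.continuous).mem_nhds hp)
  have hτz : ∀ b p, E.proj p ∈ U b → ∀ z : Circle, τ b (z • p) = z * τ b p := by
    intro b p hp z
    refine E.smul_right_cancel (p := s b (E.proj p)) ?_
    have h1 := hτ b (z • p) (by rwa [E.proj_smul])
    rw [E.proj_smul] at h1
    rw [h1, mul_smul, hτ b p hp]
  -- Over `U b` the trivialisation gives the connection `τ⁻¹ dτ`.
  refine ⟨DForm.glue ρ E.proj fun b => DForm.dlog (τ b), ?_, fun z => ?_, fun p r => ?_⟩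
  · exact DForm.isSmooth_glue hρ E.proj_smooth fun b p hp => DForm.smoothAt_dlog (hτA b p hp)
  · have hz : E.proj ∘ (fun p : E.P => z • p) = E.proj := funext fun p => E.proj_smul z p
    rw [DForm.pullback_glue, hz]
    funext p
    refine Finset.sum_congr rfl fun b hbp => ?_
    have hp : E.proj p ∈ U b := DForm.mem_of_mem_finsupport hρ hbp
    congr 1
    change DForm.pullback (fun p => z • p) (DForm.dlog (τ b)) p = DForm.dlog (τ b) p
    rw [DForm.pullback_dlog (hτA b _ (by rwa [E.proj_smul]))
      ((E.smooth_smul z p).mdifferentiableAt (by simp)),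
      DForm.dlog_congr (g' := fun q => z * τ b q), DForm.dlog_mul contMDiffAt_const (hτA b p hp),
      DForm.dlog_const, zero_add]
    filter_upwards [((hU b).preimage E.proj_smooth.continuous).mem_nhds hp] with q hq
      using hτz b q hq z
  · have hcurve : ContMDiff 𝓘(ℝ, ℝ) (𝓡 E.P.dim) ∞ (fun r' : ℝ => Circle.exp r' • p) :=
      E.act_smooth.comp (contMDiff_circleExp.prodMk contMDiff_const)
    -- Along an orbit `τ` is multiplied by `exp (i r)`, whose logarithmic derivative is `i`.
    have key : ∀ b, E.proj p ∈ U b → DForm.dlog (τ b) (Circle.exp r • p)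
        (fun _ => mfderiv 𝓘(ℝ, ℝ) (𝓡 E.P.dim) (fun r' : ℝ => Circle.exp r' • p) r (1 : ℝ)) = 1 := by
      intro b hp
      have h1 : MDifferentiableAt (𝓡 E.P.dim) 𝓘(ℝ, ℂ) (fun q => (τ b q : ℂ)) (Circle.exp r • p) :=
        ((contMDiff_circle_coe _).comp _
          (hτA b _ (by rwa [E.proj_smul]))).mdifferentiableAt (by simp)
      have h2 := mfderiv_comp r h1 ((hcurve r).mdifferentiableAt (by simp))
      have h3 : (fun q => (τ b q : ℂ)) ∘ (fun r' : ℝ => Circle.exp r' • p) =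
          fun r' : ℝ => Complex.exp (r' * Complex.I) * (τ b p : ℂ) := by
        funext r'
        simp only [Function.comp, hτz b p hp, Circle.coe_mul, Circle.coe_exp]
      have h4 : HasDerivAt (fun r' : ℝ => Complex.exp (r' * Complex.I) * (τ b p : ℂ))
          (Complex.exp (r * Complex.I) * Complex.I * (τ b p : ℂ)) r := by
        have h5 : HasDerivAt (fun r : ℝ => ((r : ℂ) * Complex.I)) (1 * Complex.I) r :=
          (Complex.ofRealCLM.hasDerivAt (x := r)).mul_const _
        rw [one_mul] at h5
        exact h5.cexp.mul_const _
      rw [h3, mfderiv_eq_fderiv] at h2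
      have h6 := h4.deriv
      rw [← fderiv_apply_one_eq_deriv] at h6
      have h7 : mfderiv (𝓡 E.P.dim) 𝓘(ℝ, ℂ) (fun q => (τ b q : ℂ)) (Circle.exp r • p)
          (mfderiv 𝓘(ℝ, ℝ) (𝓡 E.P.dim) (fun r' : ℝ => Circle.exp r' • p) r (1 : ℝ)) =
          Complex.exp (r * Complex.I) * Complex.I * (τ b p : ℂ) :=
        (congrArg (fun φ : ℝ →L[ℝ] ℂ => φ 1) h2).symm.trans h6
      have h8 : ∀ (z : Circle) (w : ℂ), w = (z : ℂ) * Complex.I →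
          ((starRingEnd ℂ) (z : ℂ) * w).im = 1 := by
        rintro z _ rfl
        have hz : (starRingEnd ℂ) (z : ℂ) * z = 1 := by
          rw [← Circle.coe_inv_eq_conj, ← Circle.coe_mul]; simp
        rw [← mul_assoc, hz]
        simp
      have h9 : Complex.exp (r * Complex.I) * Complex.I * (τ b p : ℂ) =
          (τ b (Circle.exp r • p) : ℂ) * Complex.I := by
        rw [hτz b p hp, Circle.coe_mul, Circle.coe_exp]
        ring
      exact h8 (τ b (Circle.exp r • p)) _ (h7.trans h9)
    have h9 : ∀ b ∈ ρ.finsupport (E.proj (Circle.exp r • p)), E.proj p ∈ U b := fun b hb => by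
      rw [← E.proj_smul (Circle.exp r) p]
      exact DForm.mem_of_mem_finsupport hρ hb
    simp only [DForm.glue, ContinuousAlternatingMap.sum_apply, ContinuousAlternatingMap.smul_apply]
    rw [Finset.sum_congr rfl fun b hb => by rw [key b (h9 b hb)]]
    simpa using ρ.sum_finsupport _ (Set.mem_univ _)

/-- The curvature of a connection exists: the forms `s^* dA` for local sections `s` agree on
overlaps, since `s^* A` changes by the closed form `z⁻¹ dz` if `s` is multiplied by `z`. -/
theorem IsConnection.exists_isCurvature {B : Mfd.{u}} {E : U1Bundle B} {A : DForm E.P 1}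
    (hA : IsConnection E A) : ∃ F : DForm B 2, F.IsSmooth ∧ IsCurvature E A F := by
  choose U s hU hb hs hps using E.exists_localSection
  have hA' := DForm.isSmooth_iff.1 hA.smooth
  have hsA : ∀ b, ∀ x ∈ U b, ContMDiffAt (𝓡 B.dim) (𝓡 E.P.dim) ∞ (s b) x := fun b x hx =>
    (hs b x hx).contMDiffAt ((hU b).mem_nhds hx)
  -- For two sections of `E` along a map, the pullbacks of `dA` agree.
  have key : ∀ {T : Mfd.{u}} {V : Set T} (_ : IsOpen V) {σ σ' : T → E.P} (_ : SmoothOn σ V)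
      (_ : SmoothOn σ' V) (_ : ∀ y ∈ V, E.proj (σ' y) = E.proj (σ y)), ∀ t ∈ V,
      DForm.pullback σ' A.d t = DForm.pullback σ A.d t := by
    intro T V hV σ σ' hσ hσ' h t ht
    have hσA : ∀ y ∈ V, ContMDiffAt (𝓡 T.dim) (𝓡 E.P.dim) ∞ σ y := fun y hy =>
      (hσ y hy).contMDiffAt (hV.mem_nhds hy)
    have hσA' : ∀ y ∈ V, ContMDiffAt (𝓡 T.dim) (𝓡 E.P.dim) ∞ σ' y := fun y hy =>
      (hσ' y hy).contMDiffAt (hV.mem_nhds hy)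
    obtain ⟨z, hz, hzs⟩ := E.exists_smul_eq hV hσ hσ' h
    have h1 : ∀ᶠ y in 𝓝 t, DForm.pullback σ' A y = (DForm.dlog z + DForm.pullback σ A) y := by
      filter_upwards [hV.mem_nhds ht] with y hy
      rw [DForm.pullback_congr (g := fun y => z y • σ y) _ A, hA.pullback_smul (hz y hy) (hσA y hy)]
      · rfl
      · filter_upwards [hV.mem_nhds hy] with y' hy' using hzs y' hy'
    rw [← (hA' _).d_pullback (hσA' t ht), ← (hA' _).d_pullback (hσA t ht), DForm.d_congr h1,
      (DForm.smoothAt_dlog (hz t ht)).d_add ((hA' _).pullback (hσA t ht)),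
      DForm.d_dlog (hz t ht), zero_add]
  refine ⟨fun b => DForm.pullback (s b) A.d b, DForm.isSmooth_iff.2 fun b => ?_, ?_⟩
  · refine (((hA' _).d).pullback (hsA b b (hb b))).congr ?_
    filter_upwards [(hU b).mem_nhds (hb b)] with y hy
    refine key ((hU b).inter (hU y)) ((hs b).mono Set.inter_subset_left)
      ((hs y).mono Set.inter_subset_right) (fun x hx => ?_) y ⟨hy, hb y⟩
    rw [hps b x hx.1, hps y x hx.2]
  · funext p
    have hp : ContMDiffAt (𝓡 E.P.dim) (𝓡 B.dim) ∞ E.proj p := E.proj_smooth p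
    have h1 : DForm.pullback E.proj (fun b => DForm.pullback (s b) A.d b) p =
        DForm.pullback E.proj (DForm.pullback (s (E.proj p)) A.d) p :=
      DForm.pullback_apply_congr rfl
    rw [h1, DForm.pullback_pullback
      ((hsA _ _ (hb (E.proj p))).mdifferentiableAt (by simp)) (hp.mdifferentiableAt (by simp))]
    have h2 := key (T := E.P) (V := E.proj ⁻¹' U (E.proj p))
      ((hU _).preimage E.proj_smooth.continuous) (σ := id) (σ' := s (E.proj p) ∘ E.proj)
      contMDiff_id.contMDiffOn
      ((hs (E.proj p)).comp (E.proj_smooth.contMDiffOn) fun x hx => hx)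
      (fun y hy => hps _ _ hy) p (hb _)
    rw [h2, DForm.pullback_id]

/-! ### Pulling back connections along sections of tensor products -/

theorem altSign_cast {n : ℕ} (i : Fin n) : ((altSign i : ℤ) : ℝ) = (-1 : ℝ) ^ (i : ℕ) := by
  simp [altSign]

/-- Finitely many pullbacks of a circle bundle have local sections over a common neighbourhood. -/
theorem U1Bundle.exists_frame {B T : Mfd.{u}} (E : U1Bundle B) {κ : Type*} [Finite κ]
    {h : κ → T → B} (hh : ∀ i, Smooth (h i)) (t : T) :
    ∃ (U : Set T) (s : κ → T → E.P), IsOpen U ∧ t ∈ U ∧ (∀ i, SmoothOn (s i) U) ∧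
      ∀ i, ∀ y ∈ U, E.proj (s i y) = h i y := by
  choose U s hU hb hs hps using E.exists_localSection
  refine ⟨⋂ i, h i ⁻¹' U (h i t), fun i => s (h i t) ∘ h i,
    isOpen_iInter_of_finite fun i => (hU _).preimage (hh i).continuous,
    Set.mem_iInter.2 fun i => hb _, fun i => ?_, fun i y hy => ?_⟩
  · exact (hs (h i t)).comp (hh i).contMDiffOn fun y hy => Set.mem_iInter.1 hy i
  · exact hps _ _ (Set.mem_iInter.1 hy i)

namespace TensorSection

variable {B T T' : Mfd.{u}} {E : U1Bundle B} {ι : Type} [Fintype ι] {f : ι → T → B} {ε : ι → ℤ}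
  {σ : TensorSection E f ε} {A : DForm E.P 1} {η : DForm T 1}

/-- The local connection form `g⁻¹ dg + ∑ i, ε_i s_i^* A` does not depend on the choice of the
local sections `s_i`. -/
theorem dlog_coeff_add_sum_eq (hA : IsConnection E A) {g : T' → T} {V : Set T'} (hV : IsOpen V)
    {s p : ι → T' → E.P} (hs : ∀ i, SmoothOn (s i) V) (hp : ∀ i, SmoothOn (p i) V)
    (hsf : ∀ i, ∀ y ∈ V, E.proj (s i y) = f i (g y))
    (hpf : ∀ i, ∀ y ∈ V, E.proj (p i y) = f i (g y)) {t : T'} (ht : t ∈ V)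
    (hc : ContMDiffAt (𝓡 T'.dim) (𝓡 1) ∞ (fun y => σ.coeff (g y) (fun i => s i y)) t) :
    ContMDiffAt (𝓡 T'.dim) (𝓡 1) ∞ (fun y => σ.coeff (g y) (fun i => p i y)) t ∧
      DForm.dlog (fun y => σ.coeff (g y) (fun i => p i y)) t +
          ∑ i, (ε i : ℝ) • DForm.pullback (p i) A t =
        DForm.dlog (fun y => σ.coeff (g y) (fun i => s i y)) t +
          ∑ i, (ε i : ℝ) • DForm.pullback (s i) A t := by
  choose z hz hzs using fun i => E.exists_smul_eq hV (hs i) (hp i)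
    (fun y hy => by rw [hsf i y hy, hpf i y hy])
  have e : (fun y => σ.coeff (g y) (fun i => p i y)) =ᶠ[𝓝 t]
      fun y => (∏ i, z i y ^ (-ε i)) * σ.coeff (g y) (fun i => s i y) := by
    filter_upwards [hV.mem_nhds ht] with y hy
    rw [← σ.equivariant (g y) (fun i => s i y) (fun i => hsf i y hy) (fun i => z i y)]
    congr 1
    exact funext fun i => hzs i y hy
  have hzp : ∀ i ∈ Finset.univ, ContMDiffAt (𝓡 T'.dim) (𝓡 1) ∞ (fun y => z i y ^ (-ε i)) t :=
    fun i _ => DForm.contMDiffAt_circle_zpow (hz i t ht) _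
  refine ⟨((DForm.contMDiffAt_circle_prod hzp).mul hc).congr_of_eventuallyEq e, ?_⟩
  rw [DForm.dlog_congr e, DForm.dlog_mul (DForm.contMDiffAt_circle_prod hzp) hc,
    DForm.dlog_prod hzp]
  have hpA : ∀ i, DForm.pullback (p i) A t = DForm.dlog (z i) t + DForm.pullback (s i) A t := by
    intro i
    rw [← hA.pullback_smul (hz i t ht) ((hs i t ht).contMDiffAt (hV.mem_nhds ht))]
    refine DForm.pullback_congr ?_ A
    filter_upwards [hV.mem_nhds ht] with y hy using hzs i y hy
  simp only [DForm.dlog_zpow (hz _ t ht), hpA, smul_add, Finset.sum_add_distrib]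
  have hcancel : ∑ i, ((-ε i : ℤ) : ℝ) • DForm.dlog (z i) t +
      ∑ i, (ε i : ℝ) • DForm.dlog (z i) t = 0 := by
    rw [← Finset.sum_add_distrib]
    refine Finset.sum_eq_zero fun i _ => ?_
    rw [← add_smul, Int.cast_neg, neg_add_cancel, zero_smul]
  rw [add_add_add_comm, hcancel, zero_add]

/-- The local connection forms agree on overlaps, so that they define a form on `T`. -/
theorem exists_pullbackConnectionEq (hf : ∀ i, Smooth (f i)) (hA : IsConnection E A) :
    ∃ η : DForm T 1, η.IsSmooth ∧ σ.PullbackConnectionEq A η := by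
  choose U s hU ht hs hsf using E.exists_frame hf
  have hc : ∀ t, ∀ y ∈ U t,
      ContMDiffAt (𝓡 T.dim) (𝓡 1) ∞ (fun t' => σ.coeff t' (fun i => s t i t')) y := fun t y hy =>
    (σ.smooth (U t) (s t) (hU t) (hs t) (hsf t) y hy).contMDiffAt ((hU t).mem_nhds hy)
  let η : DForm T 1 := fun t => DForm.dlog (fun t' => σ.coeff t' (fun i => s t i t')) t +
    ∑ i, (ε i : ℝ) • DForm.pullback (s t i) A t
  have hη : σ.PullbackConnectionEq A η := by
    intro V p hV hp hpf t htV
    exact ((dlog_coeff_add_sum_eq (g := id) hA ((hU t).inter hV)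
      (fun i => (hs t i).mono Set.inter_subset_left) (fun i => (hp i).mono Set.inter_subset_right)
      (fun i y hy => hsf t i y hy.1) (fun i y hy => hpf i y hy.2) ⟨ht t, htV⟩
      (hc t t (ht t))).2).symm
  refine ⟨η, DForm.isSmooth_iff.2 fun t => ?_, hη⟩
  have h1 : DForm.SmoothAt (DForm.dlog (fun t' => σ.coeff t' (fun i => s t i t')) +
      ∑ i, (ε i : ℝ) • DForm.pullback (s t i) A) t :=
    (DForm.smoothAt_dlog (hc t t (ht t))).add (DForm.SmoothAt.sum fun i _ =>
      ((DForm.isSmooth_iff.1 hA.smooth _).pullback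
        ((hs t i t (ht t)).contMDiffAt ((hU t).mem_nhds (ht t)))).const_smul _)
  refine h1.congr ?_
  filter_upwards [(hU t).mem_nhds (ht t)] with y hy
  rw [hη (U t) (s t) (hU t) (hs t) (hsf t) y hy]
  simp [Finset.sum_apply]

/-- The local formula for the connection form pulled back along `g : T' → T`, for sections of the
bundles `(f_i ∘ g)^* E` over `T'` that need not come from `T`. -/
theorem PullbackConnectionEq.pullback (h : σ.PullbackConnectionEq A η) (hf : ∀ i, Smooth (f i))
    (hA : IsConnection E A) {g : T' → T} (hg : Smooth g) {V : Set T'} (hV : IsOpen V)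
    {p : ι → T' → E.P} (hp : ∀ i, SmoothOn (p i) V)
    (hpf : ∀ i, ∀ y ∈ V, E.proj (p i y) = f i (g y)) {t : T'} (ht : t ∈ V) :
    ContMDiffAt (𝓡 T'.dim) (𝓡 1) ∞ (fun y => σ.coeff (g y) (fun i => p i y)) t ∧
      DForm.pullback g η t = DForm.dlog (fun y => σ.coeff (g y) (fun i => p i y)) t +
        ∑ i, (ε i : ℝ) • DForm.pullback (p i) A t := by
  obtain ⟨U, s, hU, htU, hs, hsf⟩ := E.exists_frame hf (g t)
  have hgt := (hg t).mdifferentiableAt (by simp)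
  have hsU : ∀ i, ContMDiffAt (𝓡 T.dim) (𝓡 E.P.dim) ∞ (s i) (g t) := fun i =>
    (hs i _ htU).contMDiffAt (hU.mem_nhds htU)
  have hc : ContMDiffAt (𝓡 T.dim) (𝓡 1) ∞ (fun t' => σ.coeff t' (fun i => s i t')) (g t) :=
    (σ.smooth U s hU hs hsf _ htU).contMDiffAt (hU.mem_nhds htU)
  have hgU : IsOpen (g ⁻¹' U) := hU.preimage hg.continuous
  obtain ⟨h1, h2⟩ := dlog_coeff_add_sum_eq (σ := σ) (g := g) (s := fun i => s i ∘ g) hA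
    (hgU.inter hV)
    (fun i => (hs i).comp hg.contMDiffOn fun y hy => hy.1)
    (fun i => (hp i).mono Set.inter_subset_right) (fun i y hy => hsf i _ hy.1)
    (fun i y hy => hpf i y hy.2) ⟨htU, ht⟩ (hc.comp t (hg t))
  refine ⟨h1, h2.symm ▸ ?_⟩
  have h3 : η (g t) = (DForm.dlog (fun t' => σ.coeff t' (fun i => s i t')) +
      ∑ i, (ε i : ℝ) • DForm.pullback (s i) A : DForm T 1) (g t) := by
    rw [h U s hU hs hsf _ htU]
    simp [Finset.sum_apply]
  rw [DForm.pullback_apply_congr h3]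
  simp only [DForm.pullback_add, DForm.pullback_sum, DForm.pullback_smul, Pi.add_apply,
    Finset.sum_apply, Pi.smul_apply]
  rw [DForm.pullback_dlog hc hgt]
  congr 1
  exact Finset.sum_congr rfl fun i _ => by
    rw [DForm.pullback_pullback ((hsU i).mdifferentiableAt (by simp)) hgt]

/-- If a form `b` on the base is subtracted from the connection, its alternating sum of pullbacks is
subtracted from the connection form of `σ`. -/
theorem PullbackConnectionEq.sub_pullback_proj (h : σ.PullbackConnectionEq A η)
    (b : DForm B 1) :
    σ.PullbackConnectionEq (A - DForm.pullback E.proj b)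
      (η - ∑ i, (ε i : ℝ) • DForm.pullback (f i) b) := by
  intro U s hU hs hsf t ht
  have e : ∀ i, DForm.pullback (s i) (DForm.pullback E.proj b) t = DForm.pullback (f i) b t := by
    intro i
    rw [DForm.pullback_pullback ((E.proj_smooth _).mdifferentiableAt (by simp))
      (((hs i t ht).contMDiffAt (hU.mem_nhds ht)).mdifferentiableAt (by simp))]
    refine DForm.pullback_congr ?_ b
    filter_upwards [hU.mem_nhds ht] with y hy using hsf i y hy
  have e' : (η - ∑ i, (ε i : ℝ) • DForm.pullback (f i) b) t =
      η t - ∑ i, (ε i : ℝ) • DForm.pullback (f i) b t := by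
    simp [Finset.sum_apply]
  rw [e', h U s hU hs hsf t ht]
  simp only [DForm.pullback_sub, Pi.sub_apply, e, smul_sub, Finset.sum_sub_distrib]
  rw [add_sub_assoc]

theorem _root_.IsConnection.sub_pullback_proj (hA : IsConnection E A) {b : DForm B 1}
    (hb : b.IsSmooth) : IsConnection E (A - DForm.pullback E.proj b) where
  smooth := hA.smooth.sub (hb.pullback E.proj_smooth)
  invariant z := by
    rw [DForm.pullback_sub, hA.invariant,
      DForm.pullback_pullback' E.proj_smooth (E.smooth_smul z)]
    have hz : E.proj ∘ (fun p : E.P => z • p) = E.proj := funext fun p => E.proj_smul z p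
    rw [hz]
  vertical p r := by
    have hcurve : ContMDiff 𝓘(ℝ, ℝ) (𝓡 E.P.dim) ∞ (fun r' : ℝ => Circle.exp r' • p) :=
      E.act_smooth.comp (contMDiff_circleExp.prodMk contMDiff_const)
    have h1 := mfderiv_comp r ((E.proj_smooth _).mdifferentiableAt (by simp))
      ((hcurve r).mdifferentiableAt (by simp))
    have h2 : E.proj ∘ (fun r' : ℝ => Circle.exp r' • p) = fun _ => E.proj p :=
      funext fun r' => E.proj_smul _ p
    rw [h2, mfderiv_const] at h1
    have h3 : DForm.pullback E.proj b (Circle.exp r • p)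
        (fun _ => mfderiv 𝓘(ℝ, ℝ) (𝓡 E.P.dim) (fun r' : ℝ => Circle.exp r' • p) r (1 : ℝ)) = 0 := by
      have h4 : ∀ (v : TangentSpace (𝓡 B.dim) (E.proj (Circle.exp r • p))), v = 0 →
          b (E.proj (Circle.exp r • p)) (fun _ => v) = 0 := by
        rintro _ rfl
        exact (b (E.proj (Circle.exp r • p))).map_coord_zero (0 : Fin 1) rfl
      exact h4 _ (congrArg (fun φ : ℝ →L[ℝ] EuclideanSpace ℝ (Fin B.dim) => φ 1) h1).symm
    have h5 := hA.vertical p r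
    rw [Pi.sub_apply, ContinuousAlternatingMap.sub_apply, h3, sub_zero]
    exact h5

/-- The curvature of the connection on a tensor product is the alternating sum of the curvatures
of its factors. -/
theorem PullbackConnectionEq.d_eq (h : σ.PullbackConnectionEq A η) (hf : ∀ i, Smooth (f i))
    (hA : IsConnection E A) {F : DForm B 2} (hF : IsCurvature E A F) :
    η.d = ∑ i, (ε i : ℝ) • DForm.pullback (f i) F := by
  funext t
  obtain ⟨U, s, hU, htU, hs, hsf⟩ := E.exists_frame hf t
  have hsU : ∀ i, ContMDiffAt (𝓡 T.dim) (𝓡 E.P.dim) ∞ (s i) t := fun i =>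
    (hs i _ htU).contMDiffAt (hU.mem_nhds htU)
  have hc : ContMDiffAt (𝓡 T.dim) (𝓡 1) ∞ (fun t' => σ.coeff t' (fun i => s i t')) t :=
    (σ.smooth U s hU hs hsf _ htU).contMDiffAt (hU.mem_nhds htU)
  have hA' := DForm.isSmooth_iff.1 hA.smooth
  have h1 : ∀ᶠ y in 𝓝 t, η y = (DForm.dlog (fun t' => σ.coeff t' (fun i => s i t')) +
      ∑ i, (ε i : ℝ) • DForm.pullback (s i) A : DForm T 1) y := by
    filter_upwards [hU.mem_nhds htU] with y hy
    rw [h U s hU hs hsf _ hy]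
    simp [Finset.sum_apply]
  have hsA : ∀ i ∈ Finset.univ, DForm.SmoothAt ((ε i : ℝ) • DForm.pullback (s i) A) t :=
    fun i _ => ((hA' _).pullback (hsU i)).const_smul _
  rw [DForm.d_congr h1, (DForm.smoothAt_dlog hc).d_add (DForm.SmoothAt.sum hsA), DForm.d_dlog hc,
    zero_add, DForm.SmoothAt.d_sum hsA, Finset.sum_apply]
  refine Finset.sum_congr rfl fun i _ => ?_
  rw [DForm.d_smul, Pi.smul_apply, Pi.smul_apply, (hA' _).d_pullback (hsU i), ← hF,
    DForm.pullback_pullback ((E.proj_smooth _).mdifferentiableAt (by simp))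
      ((hsU i).mdifferentiableAt (by simp))]
  congr 1
  refine DForm.pullback_congr ?_ F
  filter_upwards [hU.mem_nhds htU] with y hy using hsf i y hy

/-- The local formula for `δη`: the logarithmic derivative of the coefficient of `δσ`, and the
alternating sum of the pullbacks of the connection along the chosen sections. -/
theorem PullbackConnectionEq.delta_apply (h : σ.PullbackConnectionEq A η)
    (hf : ∀ i, Smooth (f i)) (hA : IsConnection E A) {n : ℕ} {g : Fin (n + 1) → T' → T}
    (hg : ∀ j, Smooth (g j)) {V : Set T'} (hV : IsOpen V)
    {p : Fin (n + 1) → ι → T' → E.P} (hp : ∀ j i, SmoothOn (p j i) V)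
    (hpf : ∀ j i, ∀ y ∈ V, E.proj (p j i y) = f i (g j y)) {t : T'} (ht : t ∈ V) :
    DForm.delta g η t =
      DForm.dlog (fun y => ∏ j, σ.coeff (g j y) (fun i => p j i y) ^ altSign j) t +
        ∑ j : Fin (n + 1), (-1 : ℝ) ^ (j : ℕ) •
          ∑ i, (ε i : ℝ) • DForm.pullback (p j i) A t := by
  have h1 := fun j => h.pullback hf hA (hg j) hV (hp j) (hpf j) ht
  rw [DForm.delta_apply,
    DForm.dlog_prod (fun j _ => DForm.contMDiffAt_circle_zpow (h1 j).1 (altSign j)),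
    ← Finset.sum_add_distrib]
  refine Finset.sum_congr rfl fun j _ => ?_
  rw [(h1 j).2, DForm.dlog_zpow (h1 j).1, altSign_cast, smul_add]

/-- If `δσ` is the canonical section, the connection form of `σ` is `δ`-closed: with respect to
local sections of `δ²E` that agree on the pairs of mutually dual factors, the coefficient of `δσ` is
`1` and the pullbacks of the connection cancel. -/
theorem DeltaEqOne.delta_eq_zero {f : Fin 3 → T → B} {σ : TensorSection E f altSign}
    {face : Fin 4 → T' → T} (hσ : σ.DeltaEqOne face) (h : σ.PullbackConnectionEq A η)
    (hf : ∀ i, Smooth (f i)) (hface : ∀ j, Smooth (face j)) (hA : IsConnection E A)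
    (hid : ∀ i j : Fin 3, i ≤ j → f i ∘ face j.succ = f j ∘ face i.castSucc) :
    DForm.delta face η = 0 := by
  funext t
  obtain ⟨V, r, hV, ht, hr, hrf⟩ := E.exists_frame (κ := Fin 4 × Fin 3)
    (h := fun q => f q.2 ∘ face q.1) (fun q => (hf q.2).comp (hface q.1)) t
  -- The section for the factor `(j + 1, i)` of `δ²E` is the one for the dual factor `(i, j)`.
  let p : Fin 4 → Fin 3 → T' → E.P := fun j i =>
    if hij : i.castSucc < j then r (i.castSucc, j.pred (Fin.ne_zero_of_lt hij)) else r (j, i)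
  have hp : ∀ j i, SmoothOn (p j i) V := fun j i => by
    simp only [p]
    split_ifs
    exacts [hr _, hr _]
  have hpf : ∀ j i, ∀ y ∈ V, E.proj (p j i y) = f i (face j y) := by
    intro j i y hy
    simp only [p]
    split_ifs with hij
    · rw [hrf _ y hy]
      have := congrFun (hid i (j.pred (Fin.ne_zero_of_lt hij)) (by
        rw [Fin.le_pred_iff]
        exact Fin.castSucc_lt_iff_succ_le.1 hij)) y
      simp only [Function.comp, Fin.succ_pred] at this ⊢
      exact this.symm
    · exact hrf _ y hy
  have hpp : ∀ i j : Fin 3, i ≤ j → p j.succ i = p i.castSucc j := by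
    intro i j hij
    simp only [p]
    rw [dif_pos (Fin.castSucc_lt_succ_iff.2 hij),
      dif_neg fun h' => absurd (Fin.castSucc_lt_castSucc_iff.1 h') (not_lt.2 hij), Fin.pred_succ]
  rw [h.delta_apply hf hA hface hV hp hpf ht]
  simp only [altSign_cast]
  rw [sum_sum_alternating_eq_zero (fun j i => DForm.pullback (p j i) A t)
    (fun i j hij => by rw [hpp i j hij]), add_zero,
    DForm.dlog_congr (g' := fun _ => 1), DForm.dlog_const]
  · rfl
  · filter_upwards [hV.mem_nhds ht] with y hy
    exact hσ y (fun j i => p j i y) (fun j i => hpf j i y hy)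
      (fun i j hij => by rw [hpp i j hij])

/-- If `δσ = δ'σ'` as sections of a double tensor product, the connection forms `η` of `σ` and `η'`
of `σ'` satisfy `δη = δ'η'`. -/
theorem PullbackConnectionEq.delta_eq_delta {T₁ : Mfd.{u}} {f : Fin 3 → T → B} {f' : Fin 3 → T₁ → B}
    {σ : TensorSection E f altSign} {σ' : TensorSection E f' altSign} {η' : DForm T₁ 1}
    {g : Fin 3 → T' → T} {g' : Fin 3 → T' → T₁}
    (h : σ.PullbackConnectionEq A η) (h' : σ'.PullbackConnectionEq A η')
    (hf : ∀ i, Smooth (f i)) (hf' : ∀ i, Smooth (f' i)) (hg : ∀ i, Smooth (g i))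
    (hg' : ∀ i, Smooth (g' i)) (hA : IsConnection E A)
    (hcomm : ∀ a i, f i ∘ g a = f' a ∘ g' i)
    (heq : ∀ (w : T') (p : Fin 3 → Fin 3 → E.P), (∀ a i, E.proj (p a i) = f i (g a w)) →
      ∏ a, σ.coeff (g a w) (p a) ^ altSign a =
        ∏ i, σ'.coeff (g' i w) (fun a => p a i) ^ altSign i) :
    DForm.delta g η = DForm.delta g' η' := by
  funext t
  obtain ⟨V, r, hV, ht, hr, hrf⟩ := E.exists_frame (κ := Fin 3 × Fin 3)
    (h := fun q => f q.2 ∘ g q.1) (fun q => (hf q.2).comp (hg q.1)) t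
  rw [h.delta_apply hf hA hg hV (p := fun a i => r (a, i)) (fun a i => hr _)
      (fun a i => hrf _) ht,
    h'.delta_apply hf' hA hg' hV (p := fun i a => r (a, i)) (fun a i => hr _)
      (fun i a y hy => by rw [hrf _ y hy, hcomm]; rfl) ht]
  congr 1
  · refine DForm.dlog_congr ?_
    filter_upwards [hV.mem_nhds ht] with y hy
      using heq y (fun a i => r (a, i) y) (fun a i => hrf _ y hy)
  · simp only [altSign_cast, Finset.smul_sum]
    rw [Finset.sum_comm]
    refine Finset.sum_congr rfl fun i _ => Finset.sum_congr rfl fun a _ => ?_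
    rw [smul_smul, smul_smul, mul_comm]

end TensorSection

/-! ### The bisimplicial manifold -/

namespace DForm

variable {Y B : Mfd.{u}} {π : Y → B} {k : ℕ}

/-- The pullback of forms along a map with local sections is injective. -/
theorem eq_zero_of_pullback_eq_zero (hπ : Smooth π)
    (hs : ∀ b : B, ∃ (U : Set B) (s : B → Y), IsOpen U ∧ b ∈ U ∧ SmoothOn s U ∧
      ∀ x ∈ U, π (s x) = x)
    {η : DForm B k} (h : pullback π η = 0) : η = 0 := by
  funext b
  obtain ⟨U, s, hU, hb, hs, hπs⟩ := hs b
  have h1 : pullback s (pullback π η) b = 0 := by rw [h]; rfl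
  rw [pullback_pullback ((hπ _).mdifferentiableAt (by simp))
    (((hs b hb).contMDiffAt (hU.mem_nhds hb)).mdifferentiableAt (by simp)),
    pullback_congr (g := id) (by filter_upwards [hU.mem_nhds hb] with x hx using hπs x hx),
    pullback_id] at h1
  exact h1

theorem delta_face₀_pullback (hπ : Smooth π) (C : FibrePowers π) (η : DForm B k) :
    delta C.face₀ (pullback π η) = 0 := by
  have h : π ∘ C.face₀ 0 = π ∘ C.face₀ 1 := funext fun x => C.pr_eq 1 _ _ x
  funext x
  rw [delta_apply, Fin.sum_univ_two, pullback_pullback' hπ (C.face₀_smooth _),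
    pullback_pullback' hπ (C.face₀_smooth _), h]
  ext v
  simp

theorem sum_altSign_eq_delta {M N : Mfd.{u}} {n : ℕ} (f : Fin (n + 1) → M → N) (η : DForm N k) :
    ∑ i, ((altSign i : ℤ) : ℝ) • pullback (f i) η = delta f η := by
  simp only [altSign_cast, delta]

end DForm

namespace TruncSimplicialMfd

variable {N : ℕ} (Z : TruncSimplicialMfd.{u} N)

theorem face_smooth {n : ℕ} (hn : n + 1 ≤ N) (i : Fin (n + 2)) : Smooth (Z.face hn i) :=
  Z.map_smooth _ _ _

theorem face_face {n : ℕ} (hn : n + 2 ≤ N) {i j : Fin (n + 2)} (h : i ≤ j)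
    (z : Z.obj (n + 2)) :
    Z.face (n := n) (Nat.le_of_succ_le hn) i (Z.face hn j.succ z) =
      Z.face (Nat.le_of_succ_le hn) j (Z.face hn i.castSucc z) := by
  simp only [face]
  rw [← Z.map_comp, ← Z.map_comp]
  congr 1
  ext l
  exact congrArg Fin.val (FibrePowers.succAbove_succAbove_of_le h l)

theorem face_comp_face {n : ℕ} (hn : n + 2 ≤ N) {i j : Fin (n + 2)} (h : i ≤ j) :
    Z.face (n := n) (Nat.le_of_succ_le hn) i ∘ Z.face hn j.succ =
      Z.face (Nat.le_of_succ_le hn) j ∘ Z.face hn i.castSucc :=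
  funext fun z => Z.face_face hn h z

end TruncSimplicialMfd

namespace SimplicialSubmersion

variable {X : Mfd.{u}} (S : SimplicialSubmersion X)

theorem hface_smooth {n : ℕ} (hn : n + 1 ≤ 4) (k : ℕ) (i : Fin (n + 2)) :
    Smooth (S.hface hn k i) := by
  unfold hface hmap
  apply FibrePowers.lift_smooth

theorem pr_hface {n : ℕ} (hn : n + 1 ≤ 4) (k : ℕ) (i : Fin (n + 2)) (a : Fin (k + 1))
    (w : (S.V (n + 1) hn).obj k) :
    (S.V n (Nat.le_of_succ_le hn)).pr k a (S.hface hn k i w) =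
      S.Z.face hn i ((S.V (n + 1) hn).pr k a w) := by
  unfold hface hmap
  apply FibrePowers.pr_lift

theorem hface_comp_hface {n : ℕ} (hn : n + 2 ≤ 4) (k : ℕ) {i j : Fin (n + 2)} (h : i ≤ j) :
    S.hface (n := n) (Nat.le_of_succ_le hn) k i ∘ S.hface hn k j.succ =
      S.hface (Nat.le_of_succ_le hn) k j ∘ S.hface hn k i.castSucc := by
  funext w
  apply FibrePowers.ext
  intro a
  simp only [Function.comp, pr_hface, S.Z.face_face hn h]

theorem hface_comp_face {n : ℕ} (hn : n + 1 ≤ 4) (k : ℕ) (i : Fin (n + 2)) (a : Fin (k + 2)) :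
    S.hface hn k i ∘ (S.V (n + 1) hn).face a =
      (S.V n (Nat.le_of_succ_le hn)).face a ∘ S.hface hn (k + 1) i := by
  funext w
  apply FibrePowers.ext
  intro l
  simp only [Function.comp, pr_hface, FibrePowers.pr_face]

theorem face_comp_face₀ {n : ℕ} (hn : n + 1 ≤ 4) (i : Fin (n + 2)) (a : Fin 2) :
    S.Z.face hn i ∘ (S.V (n + 1) hn).face₀ a =
      (S.V n (Nat.le_of_succ_le hn)).face₀ a ∘ S.hface hn 1 i := by
  funext w
  simp only [Function.comp, pr_hface, FibrePowers.face₀]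

theorem π_smooth (n : ℕ) (hn : n ≤ 4) : Smooth (S.π n hn) := (S.π_submersion n hn).smooth

theorem π_comp_face {n : ℕ} (hn : n + 1 ≤ 4) (i : Fin (n + 2)) :
    S.π n (Nat.le_of_succ_le hn) ∘ S.Z.face hn i = S.C.face i ∘ S.π (n + 1) hn :=
  funext fun z => S.π_map _ _ _ z

/-! #### Forms on the bisimplicial manifold -/

variable {k : ℕ}

/-- The vertical and horizontal differentials of forms on `Z_n` commute. -/
theorem deltaV_deltaH {n : ℕ} (hn : n + 1 ≤ 4) (η : DForm (S.Z.obj n) k) :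
    DForm.delta (S.V (n + 1) hn).face₀ (DForm.delta (fun i => S.Z.face hn i) η) =
      DForm.delta (fun i => S.hface hn 1 i)
        (DForm.delta (S.V n (Nat.le_of_succ_le hn)).face₀ η) :=
  DForm.delta_comm (S.Z.face_smooth hn) (FibrePowers.face₀_smooth _) (S.hface_smooth hn 1)
    (FibrePowers.face₀_smooth _) (fun i a => S.face_comp_face₀ hn i a) η

theorem deltaH_deltaH {n : ℕ} (hn : n + 2 ≤ 4) (η : DForm (S.Z.obj n) k) :
    DForm.delta (fun i => S.Z.face hn i)
      (DForm.delta (fun i => S.Z.face (Nat.le_of_succ_le hn) i) η) = 0 :=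
  DForm.delta_delta (S.Z.face_smooth _) (S.Z.face_smooth _)
    (fun _ _ h => S.Z.face_comp_face hn h) η

theorem deltaH_pullback {n : ℕ} (hn : n + 1 ≤ 4) (η : DForm (S.C.obj n) k) :
    DForm.delta (fun i => S.Z.face hn i) (DForm.pullback (S.π n (Nat.le_of_succ_le hn)) η) =
      DForm.pullback (S.π (n + 1) hn) (DForm.delta (S.C.face (n := n)) η) :=
  DForm.delta_pullback (S.Z.face_smooth hn) (S.π_smooth _ _) S.C.face_smooth (S.π_smooth _ _)
    (fun i => S.π_comp_face hn i) η

theorem deltaV_pullback {n : ℕ} (hn : n ≤ 4) (η : DForm (S.C.obj n) k) :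
    DForm.delta (S.V n hn).face₀ (DForm.pullback (S.π n hn) η) = 0 :=
  DForm.delta_face₀_pullback (S.π_smooth n hn) (S.V n hn) η

/-- A form on `Z_{n+1}` that is closed for the vertical and the horizontal differential is the
pullback of a form on `Y^{[n+2]}`, which is closed because the pullback to `Z_{n+2}` is
injective. -/
theorem exists_pullback_eq {n : ℕ} (hn : n + 2 ≤ 4) {η : DForm (S.Z.obj (n + 1)) k}
    (hη : η.IsSmooth) (hV : DForm.delta (S.V (n + 1) (Nat.le_of_succ_le hn)).face₀ η = 0)
    (hH : DForm.delta (fun i => S.Z.face hn i) η = 0) :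
    ∃ ζ : DForm (S.C.obj (n + 1)) k, ζ.IsSmooth ∧ DForm.delta (S.C.face (n := n + 1)) ζ = 0 ∧
      DForm.pullback (S.π (n + 1) (Nat.le_of_succ_le hn)) ζ = η := by
  obtain ⟨ζ, hζ, h⟩ := DForm.exists_pullback_eq (S.π_submersion _ _) _ hη hV
  refine ⟨ζ, hζ, ?_, h⟩
  refine DForm.eq_zero_of_pullback_eq_zero (S.π_smooth (n + 2) hn)
    (S.π_submersion _ _).exists_localSection ?_
  rw [← S.deltaH_pullback hn, h, hH]

end SimplicialSubmersion

/-! ### The connective structure -/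

namespace RigidBundle2Gerbe

variable {X : Mfd.{u}} (G : RigidBundle2Gerbe X)

/-- A bundle gerbe connection: the pullback of `δ∇` along `m` is `δb` for some 1-form `b` on
`Z_1^{[2]}`, and subtracting `b` from `∇` makes it vanish. -/
theorem exists_bundleGerbeConnection : ∃ A : DForm G.gerbe.E.P 1, IsConnection G.gerbe.E A ∧
    G.gerbe.m.PullbackConnectionEq A 0 := by
  obtain ⟨A, hA⟩ := G.gerbe.E.exists_isConnection
  obtain ⟨η, hη, hm⟩ := TensorSection.exists_pullbackConnectionEq (σ := G.gerbe.m)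
    (fun i => FibrePowers.face_smooth _ i) hA
  have h0 : DForm.delta ((G.V 1 (by norm_num)).face (n := 2)) η = 0 :=
    G.gerbe.assoc.delta_eq_zero hm (fun i => FibrePowers.face_smooth _ i)
      (fun i => FibrePowers.face_smooth _ i) hA fun i j h => FibrePowers.face_comp_face _ h
  obtain ⟨b, hb, hbη⟩ := DForm.exists_delta_face_eq (G.π_submersion 1 _) _ hη h0
  refine ⟨_, hA.sub_pullback_proj hb, ?_⟩
  have h1 := hm.sub_pullback_proj b
  rw [DForm.sum_altSign_eq_delta, hbη, sub_self] at h1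
  exact h1

/-- The 1-form `α` with `δ_v α = M^* δ_h ∇` and `δ_h α = 0`. By `δ_v(M) = δ_h(m)` the form
`M^* δ_h ∇` is `δ_v`-closed, hence `δ_v α₀` for some `α₀`, and `δ_h(M) = 1` shows that `δ_h α₀` is
`δ_v`-closed. -/
theorem exists_oneForm {A : DForm G.gerbe.E.P 1} (hA : IsConnection G.gerbe.E A)
    (hm : G.gerbe.m.PullbackConnectionEq A 0) : ∃ α : DForm (G.Z.obj 2) 1, α.IsSmooth ∧
      G.M.PullbackConnectionEq A (DForm.delta (G.V 2 (by norm_num)).face₀ α) ∧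
      DForm.delta (fun i => G.Z.face (n := 2) (by norm_num) i) α = 0 := by
  obtain ⟨η, hη, hM⟩ := TensorSection.exists_pullbackConnectionEq (σ := G.M)
    (fun i => G.hface_smooth _ 1 i) hA
  have hV : DForm.delta ((G.V 2 (by norm_num)).face (n := 1)) η = 0 := by
    rw [hM.delta_eq_delta hm (fun i => G.hface_smooth _ 1 i)
      (fun i => FibrePowers.face_smooth _ i) (fun i => FibrePowers.face_smooth _ i)
      (fun i => G.hface_smooth _ 2 i) hA (fun a i => G.hface_comp_face _ 1 i a) G.deltaV_M,
      DForm.delta_zero]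
  obtain ⟨α₀, hα₀, hαη⟩ := DForm.exists_delta_face₀_eq (G.π_submersion 2 _) _ hη hV
  have hH : DForm.delta (fun i => G.hface (n := 2) (by norm_num) 1 i) η = 0 :=
    G.deltaH_M.delta_eq_zero hM (fun i => G.hface_smooth _ 1 i) (fun i => G.hface_smooth _ 1 i) hA
      fun i j h => G.hface_comp_hface _ 1 h
  -- `δ_h α₀` is the pullback of `ρ = δτ` on `Y^{[4]}`, and `α = α₀ - π^* τ`.
  obtain ⟨ρ, hρ, hρ0, hρα⟩ := G.exists_pullback_eq (n := 2) (by norm_num)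
    (hα₀.delta (G.Z.face_smooth (by norm_num)))
    (by rw [G.deltaV_deltaH, hαη, hH]) (G.deltaH_deltaH (by norm_num) α₀)
  obtain ⟨τ, hτ, hτρ⟩ := DForm.exists_delta_face_eq G.proj_submersion G.C hρ hρ0
  refine ⟨α₀ - DForm.pullback (G.π 2 (by norm_num)) τ,
    hα₀.sub (hτ.pullback (G.π_smooth _ _)), ?_, ?_⟩
  · rw [DForm.delta_sub, hαη, G.deltaV_pullback, sub_zero]
    exact hM
  · rw [DForm.delta_sub, G.deltaH_pullback, hτρ, hρα, sub_self]

/-- The curving `β`, with `d α = δ_h β`. The curvature is `δ_v`-closed because `m^* δ_v ∇ = 0`,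
hence `δ_v β₀` for some `β₀`, and `d α - δ_h β₀` is `δ_v`-closed because `δ_v α = M^* δ_h ∇`. -/
theorem exists_curving {A : DForm G.gerbe.E.P 1} (hA : IsConnection G.gerbe.E A)
    (hm : G.gerbe.m.PullbackConnectionEq A 0) {α : DForm (G.Z.obj 2) 1} (hα : α.IsSmooth)
    (hM : G.M.PullbackConnectionEq A (DForm.delta (G.V 2 (by norm_num)).face₀ α))
    (hH : DForm.delta (fun i => G.Z.face (n := 2) (by norm_num) i) α = 0) :
    ∃ β : DForm (G.Z.obj 1) 2, β.IsSmooth ∧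
      IsCurvature G.gerbe.E A (DForm.delta (G.V 1 (by norm_num)).face₀ β) ∧
      α.d = DForm.delta (fun i => G.Z.face (n := 1) (by norm_num) i) β := by
  obtain ⟨F, hF, hFA⟩ := hA.exists_isCurvature
  have hV : DForm.delta ((G.V 1 (by norm_num)).face (n := 1)) F = 0 := by
    have h1 := hm.d_eq (fun i => FibrePowers.face_smooth _ i) hA hFA
    rw [DForm.sum_altSign_eq_delta, DForm.d_zero] at h1
    exact h1.symm
  obtain ⟨β₀, hβ₀, hβF⟩ := DForm.exists_delta_face₀_eq (G.π_submersion 1 _) _ hF hV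
  have hdα := hM.d_eq (fun i => G.hface_smooth _ 1 i) hA hFA
  rw [DForm.sum_altSign_eq_delta, hα.d_delta (FibrePowers.face₀_smooth _)] at hdα
  have hδβ₀ := hβ₀.delta (G.Z.face_smooth (n := 1) (by norm_num))
  -- `d α - δ_h β₀` is the pullback of `τ = δκ` on `Y^{[3]}`, and `β = β₀ + π^* κ`.
  obtain ⟨τ, hτ, hτ0, hτα⟩ := G.exists_pullback_eq (n := 1) (by norm_num) (hα.d.sub hδβ₀)
    (by rw [DForm.delta_sub, hdα, G.deltaV_deltaH, hβF, sub_self])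
    (by rw [DForm.delta_sub, G.deltaH_deltaH (by norm_num) β₀,
          ← hα.d_delta (G.Z.face_smooth (by norm_num)), hH, DForm.d_zero, sub_zero])
  obtain ⟨κ, hκ, hκτ⟩ := DForm.exists_delta_face_eq G.proj_submersion G.C hτ hτ0
  refine ⟨β₀ + DForm.pullback (G.π 1 (by norm_num)) κ,
    hβ₀.add (hκ.pullback (G.π_smooth _ _)), ?_, ?_⟩
  · rw [DForm.delta_add, hβF, G.deltaV_pullback, add_zero]
    exact hFA
  · rw [DForm.delta_add, G.deltaH_pullback, hκτ, hτα, add_sub_cancel]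

/-- The 2-curving `λ`. The form `d β` is `δ_v`-closed because curvatures are closed, and
`δ_h`-closed because `δ_h β` is exact; so it is the pullback of a closed form on `Y^{[2]}`. -/
theorem exists_twoCurving {A : DForm G.gerbe.E.P 1} (hA : IsConnection G.gerbe.E A)
    {α : DForm (G.Z.obj 2) 1} (hα : α.IsSmooth) {β : DForm (G.Z.obj 1) 2} (hβ : β.IsSmooth)
    (hβA : IsCurvature G.gerbe.E A (DForm.delta (G.V 1 (by norm_num)).face₀ β))
    (hαβ : α.d = DForm.delta (fun i => G.Z.face (n := 1) (by norm_num) i) β) :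
    ∃ lam : DForm G.Y 3, lam.IsSmooth ∧
      DForm.pullback (G.π 1 (by norm_num)) (DForm.delta G.C.face₀ lam) = β.d := by
  have hδβ := hβ.delta (FibrePowers.face₀_smooth (G.V 1 (by norm_num)))
  have hV : DForm.delta (G.V 1 (by norm_num)).face₀ β.d = 0 := by
    refine DForm.eq_zero_of_pullback_eq_zero G.gerbe.E.proj_smooth
      G.gerbe.E.exists_localSection ?_
    rw [← hβ.d_delta (FibrePowers.face₀_smooth _), ← hδβ.d_pullback G.gerbe.E.proj_smooth, hβA,
      hA.smooth.d_d]
  obtain ⟨μ, hμ, hμ0, hμβ⟩ := G.exists_pullback_eq (n := 0) (by norm_num) hβ.d hV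
    (by rw [← hβ.d_delta (G.Z.face_smooth (by norm_num)), ← hαβ, hα.d_d])
  obtain ⟨lam, hlam, h⟩ := DForm.exists_delta_face₀_eq G.proj_submersion G.C hμ hμ0
  exact ⟨lam, hlam, by rw [h, hμβ]⟩

end RigidBundle2Gerbe

theorem mainTheorem4 (X : Mfd.{u}) (G : RigidBundle2Gerbe X) :
    Nonempty (RigidConnectiveStructure G) := by
  obtain ⟨A, hA, hm⟩ := G.exists_bundleGerbeConnection
  obtain ⟨α, hα, hM, hH⟩ := G.exists_oneForm hA hm
  obtain ⟨β, hβ, hβA, hαβ⟩ := G.exists_curving hA hm hα hM hH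
  obtain ⟨lam, hlam, hlamβ⟩ := G.exists_twoCurving hA hα hβ hβA hαβ
  exact ⟨{
    conn := A, isConnection := hA, deltaV_conn := hm, β := β, β_smooth := hβ, deltaV_β := hβA
    lam := lam, lam_smooth := hlam, deltaH_lam := hlamβ, α := α, α_smooth := hα
    deltaV_α := hM, d_α := hαβ, deltaH_α := hH }⟩
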